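/- Let $k$ be a field of characteristic zero. For a $\mathbb{Z}$-graded $k$-vector space $\mathcal{H}=\bigoplus_{d\in\mathbb{Z}}\mathcal{H}^d$ let $C(\mathcal{H})=\bigoplus_{n\ge 0}\mathcal{H}^{\otimes n}$ be its tensor coalgebra, with the coproduct $\triangle(o_1\cdots o_n)=\sum_{i=0}^{n}(o_1\cdots o_i)\otimes(o_{i+1}\cdots o_n)$ and graded by total degree. An $A_\infty$-algebra $(\mathcal{H},\mathfrak{m})$ is such an $\mathcal{H}$ with a linear map $\mathfrak{m}:C(\mathcal{H})\to C(\mathcal{H})$ of degree one that is a coderivation, $\triangle\mathfrak{m}=(\mathfrak{m}\otimes 1+1\otimes\mathfrak{m})\triangle$ where $(1\otimes\mathfrak{m})(x\otimes y)=(-1)^{|x|}x\otimes\mathfrak{m}(y)$, and satisfies $\mathfrak{m}^2=0$ and $m_0=0$; here $m_n:\mathcal{H}^{\otimes n}\to\mathcal{H}$ is the restriction of $\mathfrak{m}$ to $\mathcal{H}^{\otimes n}$ followed by the projection to $\mathcal{H}^{\otimes 1}=\mathcal{H}$. An $A_\infty$-morphism $(\mathcal{H},\mathfrak{m})\to(\mathcal{H}',\mathfrak{m}')$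 is a (counital) coalgebra homomorphism $\mathcal{F}:C(\mathcal{H})\to C(\mathcal{H}')$ of degree zero with $\mathcal{F}\mathfrak{m}=\mathfrak{m}'\mathcal{F}$ and $f_0=0$, where the components $f_n:\mathcal{H}^{\otimes n}\to\mathcal{H}'$ are defined in the same way; it is an $A_\infty$-isomorphism if $f_1:\mathcal{H}\to\mathcal{H}'$ is an isomorphism. An $A_\infty$-algebra is minimal if $m_1=0$, and linear contractible if $m_n=0$ for all $n\ge 2$ and the complex $(\mathcal{H},m_1)$ has trivial cohomology. The direct sum of $(\mathcal{H},\mathfrak{m})$ and $(\mathcal{H}',\mathfrak{m}')$ is the $A_\infty$-algebra on $\mathcal{H}\oplus\mathcal{H}'$ whose operations are $((x_1,y_1),\dots,(x_n,y_n))\mapsto(m_n(x_1,\dots,x_n),m'_n(y_1,\dots,y_n))$. **Theorem (Decomposition theorem for $A_\infty$-algebras).** Every $A_\infty$-algebra over $k$ is $A_\infty$-isomorphic to the direct sum of a minimal $A_\infty$-algebra and a linear contractible $A_\infty$-algebra. -/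

import Mathlib

open scoped TensorProduct DirectSum

universe u u' v

noncomputable section

namespace AInfinity

section Deconcatenation

variable (k : Type v) [Field k] (V : Type u) [AddCommGroup V] [Module k V]

/-- Left multiplication by a letter `v`, together with its effect on the deconcatenation
coproduct: `(w, d) ↦ (v w, 1 ⊗ v w + (v ⊗ 1) d)`. -/
def deconcatStep :
    V →ₗ[k] Module.End k
      (TensorAlgebra k V × (TensorAlgebra k V ⊗[k] TensorAlgebra k V)) where
  toFun v :=
    ((LinearMap.mulLeft k (TensorAlgebra.ι k v)) ∘ₗ LinearMap.fst k _ _).prod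
      ((TensorProduct.mk k _ _ 1) ∘ₗ (LinearMap.mulLeft k (TensorAlgebra.ι k v)) ∘ₗ
          LinearMap.fst k _ _ +
        (LinearMap.mulLeft k (TensorAlgebra.ι k v ⊗ₜ[k] (1 : TensorAlgebra k V))) ∘ₗ
          LinearMap.snd k _ _)
  map_add' v w := by
    refine LinearMap.ext fun x => Prod.ext ?_ ?_
    · simp [add_mul]
    · simp [add_mul, TensorProduct.add_tmul, TensorProduct.tmul_add]
      abel
  map_smul' c v := by
    refine LinearMap.ext fun x => Prod.ext ?_ ?_
    · simp
    · simp [← TensorProduct.smul_tmul']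

theorem deconcatStep_apply (v : V)
    (x : TensorAlgebra k V × (TensorAlgebra k V ⊗[k] TensorAlgebra k V)) :
    deconcatStep k V v x = (TensorAlgebra.ι k v * x.1,
      1 ⊗ₜ[k] (TensorAlgebra.ι k v * x.1) + (TensorAlgebra.ι k v ⊗ₜ[k] 1) * x.2) := rfl

/-- The deconcatenation coproduct on the tensor coalgebra `C(V) = ⨁ₙ V^{⊗n}`, whose underlying
vector space is that of `TensorAlgebra k V`:
`Δ(v₁ ⋯ vₙ) = ∑ᵢ (v₁ ⋯ vᵢ) ⊗ (vᵢ₊₁ ⋯ vₙ)` for `0 ≤ i ≤ n` (see `deconcat_prod`). -/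
def deconcat : TensorAlgebra k V →ₗ[k] TensorAlgebra k V ⊗[k] TensorAlgebra k V :=
  LinearMap.snd k _ _ ∘ₗ
    LinearMap.applyₗ ((1 : TensorAlgebra k V), (1 : TensorAlgebra k V) ⊗ₜ[k] 1) ∘ₗ
      (TensorAlgebra.lift k (deconcatStep k V)).toLinearMap

theorem deconcat_one : deconcat k V 1 = 1 ⊗ₜ[k] 1 := by
  simp [deconcat]

theorem deconcat_ι_mul (v : V) (w : TensorAlgebra k V) :
    deconcat k V (TensorAlgebra.ι k v * w) =
      1 ⊗ₜ[k] (TensorAlgebra.ι k v * w) + (TensorAlgebra.ι k v ⊗ₜ[k] 1) * deconcat k V w := by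
  have hfst : ∀ w : TensorAlgebra k V,
      (TensorAlgebra.lift k (deconcatStep k V) w
        ((1 : TensorAlgebra k V), (1 : TensorAlgebra k V) ⊗ₜ[k] 1)).1 = w := by
    intro w
    have key : ∀ (w : TensorAlgebra k V) x,
        (TensorAlgebra.lift k (deconcatStep k V) w x).1 = w * x.1 := by
      intro w
      induction w using TensorAlgebra.induction with
      | algebraMap r => intro x; simp [Algebra.smul_def]
      | ι v => intro x; simp [deconcatStep_apply]
      | mul a b ha hb => intro x; simp [ha, hb, mul_assoc]
      | add a b ha hb => intro x; simp [ha, hb, add_mul]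
    simp [key]
  simp only [deconcat, LinearMap.comp_apply, AlgHom.toLinearMap_apply, map_mul,
    TensorAlgebra.lift_ι_apply, LinearMap.applyₗ_apply_apply, Module.End.mul_apply]
  simp [deconcatStep_apply, hfst]

theorem deconcat_prod (l : List V) :
    deconcat k V (l.map (TensorAlgebra.ι k)).prod =
      ∑ i ∈ Finset.range (l.length + 1),
        ((l.take i).map (TensorAlgebra.ι k)).prod ⊗ₜ[k]
          ((l.drop i).map (TensorAlgebra.ι k)).prod := by
  induction l with
  | nil => simp [deconcat_one]
  | cons v l ih =>
    rw [List.map_cons, List.prod_cons, deconcat_ι_mul, ih, List.length_cons,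
      Finset.sum_range_succ' _ (l.length + 1), Finset.mul_sum, add_comm]
    simp

end Deconcatenation

section Graded

variable (k : Type v) [Field k] (H : ℤ → Type u) [∀ d, AddCommGroup (H d)] [∀ d, Module k (H d)]

/-- The tensor coalgebra `C(H)` of the graded vector space `H = ⨁ d, H d`. -/
abbrev TensorCoalg : Type (max u v) := TensorAlgebra k (⨁ d, H d)

/-- The part of `C(H)` of total degree `d`, spanned by the words `o₁ ⋯ oₙ` in homogeneous
letters whose degrees add up to `d`. -/
def tensorDegree (d : ℤ) : Submodule k (TensorCoalg k H) :=
  Submodule.span k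
    {x | ∃ (n : ℕ) (e : Fin n → ℤ) (o : ∀ i, H (e i)), ∑ i, e i = d ∧
      x = TensorAlgebra.tprod k (⨁ d, H d) n (fun i => DirectSum.lof k ℤ H (e i) (o i))}

/-- The map of `C(H)` that multiplies the part of total degree `d` by `(-1)^d`. -/
def koszulSign : TensorCoalg k H →ₗ[k] TensorCoalg k H :=
  (TensorAlgebra.lift k ((TensorAlgebra.ι k) ∘ₗ
    DirectSum.lmap (fun d : ℤ => d.negOnePow • (LinearMap.id : H d →ₗ[k] H d))
      )).toLinearMap

variable {k H}

/-- `n`-ary component `H^{⊗n} → H'` of a linear map between tensor coalgebras: restrict to words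
of length `n`, and project to words of length one. -/
def component {H' : ℤ → Type u'} [∀ d, AddCommGroup (H' d)] [∀ d, Module k (H' d)]
    (F : TensorCoalg k H →ₗ[k] TensorCoalg k H') (n : ℕ) :
    MultilinearMap k (fun _ : Fin n => ⨁ d, H d) (⨁ d, H' d) :=
  (TensorAlgebra.ιInv ∘ₗ F).compMultilinearMap (TensorAlgebra.tprod k (⨁ d, H d) n)

end Graded

/-- An `A∞`-algebra on the `ℤ`-graded vector space `H`: a degree one coderivation `𝔪` of the
tensor coalgebra `C(H)` with `𝔪² = 0` and `m₀ = 0`. In `coderivation`, the operator `1 ⊗ 𝔪`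
carries the Koszul sign `(1 ⊗ 𝔪)(x ⊗ y) = (-1)^{|x|} x ⊗ 𝔪 y`. -/
structure AInfinityAlgebra (k : Type v) [Field k] (H : ℤ → Type u)
    [∀ d, AddCommGroup (H d)] [∀ d, Module k (H d)] where
  codiff : TensorCoalg k H →ₗ[k] TensorCoalg k H
  degree_one : ∀ (d : ℤ), ∀ x ∈ tensorDegree k H d, codiff x ∈ tensorDegree k H (d + 1)
  coderivation : deconcat k (⨁ d, H d) ∘ₗ codiff =
    (TensorProduct.map codiff LinearMap.id + TensorProduct.map (koszulSign k H) codiff) ∘ₗ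
      deconcat k (⨁ d, H d)
  sq_zero : codiff ∘ₗ codiff = 0
  component_zero : component codiff 0 = 0

namespace AInfinityAlgebra

variable {k : Type v} [Field k]
  {H : ℤ → Type u} [∀ d, AddCommGroup (H d)] [∀ d, Module k (H d)]
  {H' : ℤ → Type u'} [∀ d, AddCommGroup (H' d)] [∀ d, Module k (H' d)]

/-- The multilinear operation `mₙ`. -/
def m (X : AInfinityAlgebra k H) (n : ℕ) :
    MultilinearMap k (fun _ : Fin n => ⨁ d, H d) (⨁ d, H d) :=
  component X.codiff n

/-- `m₁ = 0`. -/
def IsMinimal (X : AInfinityAlgebra k H) : Prop :=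
  X.m 1 = 0

/-- `mₙ = 0` for `n ≥ 2`, and the complex `(H, m₁)` has trivial cohomology. -/
def IsLinearContractible (X : AInfinityAlgebra k H) : Prop :=
  (∀ n, 2 ≤ n → X.m n = 0) ∧
    ∀ x : ⨁ d, H d, X.m 1 (fun _ => x) = 0 → ∃ y : ⨁ d, H d, X.m 1 (fun _ => y) = x

/-- `S` is the direct sum of `X` and `Y`: its underlying graded space is the degreewise direct
sum, and `mₙ((x₁, y₁), …, (xₙ, yₙ)) = (mₙ(x₁, …, xₙ), mₙ(y₁, …, yₙ))` for all `n`. -/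
def IsDirectSum (S : AInfinityAlgebra k (fun d => H d × H' d))
    (X : AInfinityAlgebra k H) (Y : AInfinityAlgebra k H') : Prop :=
  ∀ (n : ℕ) (o : Fin n → ⨁ d, H d × H' d),
    DirectSum.lmap (fun d => LinearMap.fst k (H d) (H' d)) (S.m n o) =
        X.m n (fun i => DirectSum.lmap (fun d => LinearMap.fst k (H d) (H' d)) (o i)) ∧
      DirectSum.lmap (fun d => LinearMap.snd k (H d) (H' d)) (S.m n o) =
        Y.m n (fun i => DirectSum.lmap (fun d => LinearMap.snd k (H d) (H' d)) (o i))

end AInfinityAlgebra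

/-- An `A∞`-morphism: a degree zero (counital) homomorphism of tensor coalgebras that commutes
with the codifferentials and has `f₀ = 0`. -/
structure AInfinityMorphism {k : Type v} [Field k]
    {H : ℤ → Type u} [∀ d, AddCommGroup (H d)] [∀ d, Module k (H d)]
    {H' : ℤ → Type u'} [∀ d, AddCommGroup (H' d)] [∀ d, Module k (H' d)]
    (X : AInfinityAlgebra k H) (Y : AInfinityAlgebra k H') where
  toLinearMap : TensorCoalg k H →ₗ[k] TensorCoalg k H'
  degree_zero : ∀ (d : ℤ), ∀ x ∈ tensorDegree k H d, toLinearMap x ∈ tensorDegree k H' d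
  counit_comp : ∀ x, TensorAlgebra.algebraMapInv (toLinearMap x) =
    TensorAlgebra.algebraMapInv x
  deconcat_comp : deconcat k (⨁ d, H' d) ∘ₗ toLinearMap =
    TensorProduct.map toLinearMap toLinearMap ∘ₗ deconcat k (⨁ d, H d)
  comm : toLinearMap ∘ₗ X.codiff = Y.codiff ∘ₗ toLinearMap
  component_zero : component toLinearMap 0 = 0

namespace AInfinityMorphism

variable {k : Type v} [Field k]
  {H : ℤ → Type u} [∀ d, AddCommGroup (H d)] [∀ d, Module k (H d)]
  {H' : ℤ → Type u'} [∀ d, AddCommGroup (H' d)] [∀ d, Module k (H' d)]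
  {X : AInfinityAlgebra k H} {Y : AInfinityAlgebra k H'}

/-- The multilinear component `fₙ`. -/
def f (F : AInfinityMorphism X Y) (n : ℕ) :
    MultilinearMap k (fun _ : Fin n => ⨁ d, H d) (⨁ d, H' d) :=
  component F.toLinearMap n

/-- `F` is an `A∞`-isomorphism: the linear map `f₁ : H → H'` is an isomorphism. -/
def IsIso (F : AInfinityMorphism X Y) : Prop :=
  Function.Bijective (fun x : ⨁ d, H d => F.f 1 (fun _ => x))

end AInfinityMorphism

end AInfinity

end

/-! Write `d` for `m₁`, `D` for the coderivation extending `d`, and `μ = 𝔪 - D` for the part of the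
codifferential made of the higher operations. Over a field the complex `(H, d)` splits: there is a
homotopy `h` of degree `-1` with `dhd = d`, `hdh = h` and `h² = 0` (`exists_homotopy`), so `dh + hd`
is an idempotent. Its image `B` is contractible, and the image `A` of the complementary idempotent
has zero differential; `p, i` and `b, j` denote the projections to and inclusions of `A` and `B`.

The minimal structure on `A` comes from homological perturbation. The tensor trick extends `h` to an
operator `T` on words with `DT + TD = 1 - ip` (`IsRetract.twist_homotopy`). Since `m₀ = 0` and `m₁`
has been removed, `μ` strictly shortens words (`sub_twist_mem_filt`); so `μT` is locally nilpotent,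
`1 + μT` is invertible, and `q = p (1 + μT)⁻¹` makes sense. This `q` is a coalgebra homomorphism
(`IsRetract.deconcat_lift`) and satisfies `q𝔪 = (q𝔪i)q` (`IsRetract.lift_comm`). Hence `q𝔪i` is a
structure on `A`, minimal because `di = 0`, and `q` is a morphism onto it (`exists_minimal_model`).

For the contractible part, put `φ = h ∘ ιInv`. The null-homotopic map `dφ + φ𝔪` is a chain map from
`C(H)` to `(H, d)`, and its restriction to letters is `dh + hd = jb`. Composed with `b` it becomes a
chain map to `B`, where no higher operations are needed. The coalgebra homomorphism `F = cofree f`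
whose corestriction `f` pairs `q` with this map has the bijective linear part `(p, b)`, so it is
bijective, again by unipotence with respect to word length. The codifferential is transported along
`F`, and the two chain map properties say exactly that the result is the direct sum
(`exists_decomposition_of_splitting`). -/

noncomputable section

namespace AInfinity

open TensorAlgebra (ι ιInv algebraMapInv)

/-! ### Words, the filtration by length, and the counit identities. -/

section Words

variable {k : Type v} [Field k] {V : Type u} [AddCommGroup V] [Module k V]
  {W : Type u'} [AddCommGroup W] [Module k W]

variable (k) in
/-- The word `v₁ ⋯ vₙ` in the tensor coalgebra. -/
def word (l : List V) : TensorAlgebra k V := (l.map (ι k)).prod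

@[simp] theorem word_nil : word k ([] : List V) = 1 := rfl

@[simp] theorem word_cons (a : V) (l : List V) : word k (a :: l) = ι k a * word k l := by
  simp [word]

theorem deconcat_word (l : List V) :
    deconcat k V (word k l) =
      ∑ i ∈ Finset.range (l.length + 1), word k (l.take i) ⊗ₜ[k] word k (l.drop i) :=
  deconcat_prod k V l

/-- All maps below are defined by recursion on the leftmost letter, and this is the matching
induction. Proving that left multiplication by `x` preserves `C` is what makes the case of products
go through. -/
theorem ι_mul_induction {C : TensorAlgebra k V → Prop} (one : C 1)
    (add : ∀ x y, C x → C y → C (x + y)) (smul : ∀ (c : k) x, C x → C (c • x))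
    (ι_mul : ∀ a x, C x → C (ι k a * x)) (x : TensorAlgebra k V) : C x := by
  suffices h : ∀ y, C y → C (x * y) by simpa using h 1 one
  induction x using TensorAlgebra.induction with
  | algebraMap r => intro y hy; rw [← Algebra.smul_def]; exact smul r y hy
  | ι a => exact ι_mul a
  | mul a b ha hb => intro y hy; rw [mul_assoc]; exact ha _ (hb y hy)
  | add a b ha hb => intro y hy; rw [add_mul]; exact add _ _ (ha y hy) (hb y hy)

theorem linearMap_ext_ι_mul {M : Type*} [AddCommGroup M] [Module k M]
    {f g : TensorAlgebra k V →ₗ[k] M} (one : f 1 = g 1)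
    (ι_mul : ∀ a x, f x = g x → f (ι k a * x) = g (ι k a * x)) : f = g := by
  ext x
  induction x using ι_mul_induction with
  | one => exact one
  | add x y hx hy => rw [map_add, map_add, hx, hy]
  | smul c x hx => rw [map_smul, map_smul, hx]
  | ι_mul a x hx => exact ι_mul a x hx

variable (k V) in
/-- The span of the words of length less than `n`. -/
def filt (n : ℕ) : Submodule k (TensorAlgebra k V) :=
  Submodule.span k (word k '' {l | l.length < n})

theorem word_mem_filt {l : List V} {n : ℕ} (h : l.length < n) : word k l ∈ filt k V n :=
  Submodule.subset_span ⟨l, h, rfl⟩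

theorem filt_mono {m n : ℕ} (h : m ≤ n) : filt k V m ≤ filt k V n :=
  Submodule.span_mono (Set.image_mono fun _ hl => lt_of_lt_of_le hl h)

theorem eq_zero_of_mem_filt_zero {x : TensorAlgebra k V} (h : x ∈ filt k V 0) : x = 0 := by
  simpa [filt] using h

theorem filt_le_comap {M : Submodule k (TensorAlgebra k W)} {n : ℕ}
    {f : TensorAlgebra k V →ₗ[k] TensorAlgebra k W}
    (h : ∀ l : List V, l.length < n → f (word k l) ∈ M) {x : TensorAlgebra k V}
    (hx : x ∈ filt k V n) : f x ∈ M := by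
  have : filt k V n ≤ M.comap f := by
    rw [filt, Submodule.span_le]
    rintro _ ⟨l, hl, rfl⟩
    exact h l hl
  exact this hx

theorem ι_mul_mem_filt {n : ℕ} (a : V) {x : TensorAlgebra k V} (hx : x ∈ filt k V n) :
    ι k a * x ∈ filt k V (n + 1) := by
  refine filt_le_comap (f := LinearMap.mulLeft k (ι k a)) (fun l hl => ?_) hx
  rw [LinearMap.mulLeft_apply, ← word_cons]
  exact word_mem_filt (by simpa using hl)

theorem exists_mem_filt (x : TensorAlgebra k V) : ∃ n, x ∈ filt k V n := by
  induction x using ι_mul_induction with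
  | one => exact ⟨1, word_mem_filt (l := []) (by simp)⟩
  | add x y hx hy =>
    obtain ⟨m, hm⟩ := hx
    obtain ⟨n, hn⟩ := hy
    exact ⟨max m n, add_mem (filt_mono (le_max_left _ _) hm) (filt_mono (le_max_right _ _) hn)⟩
  | smul c x hx =>
    obtain ⟨m, hm⟩ := hx
    exact ⟨m, Submodule.smul_mem _ _ hm⟩
  | ι_mul a x hx =>
    obtain ⟨m, hm⟩ := hx
    exact ⟨m + 1, ι_mul_mem_filt a hm⟩

theorem linearMap_ext_word {M : Type*} [AddCommGroup M] [Module k M]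
    {f g : TensorAlgebra k V →ₗ[k] M} (h : ∀ l, f (word k l) = g (word k l)) : f = g := by
  refine LinearMap.ext fun x => ?_
  obtain ⟨n, hn⟩ := exists_mem_filt x
  have : filt k V n ≤ LinearMap.eqLocus f g := by
    rw [filt, Submodule.span_le]
    rintro _ ⟨l, -, rfl⟩
    exact h l
  exact this hn

@[simp] theorem algebraMapInv_ι_mul (a : V) (x : TensorAlgebra k V) :
    algebraMapInv (ι k a * x) = 0 := by
  simp [algebraMapInv]

@[simp] theorem ιInv_ι (a : V) : ιInv (ι k a) = a := TensorAlgebra.ι_leftInverse a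

@[simp] theorem ιInv_one : ιInv (1 : TensorAlgebra k V) = 0 := by
  -- `ιInv` factors through the trivial square-zero extension, which needs a right action; these are
  -- the instances used in its definition.
  let : Module kᵐᵒᵖ V := Module.compHom _ ((RingHom.id k).fromOpposite mul_comm)
  have : IsCentralScalar k V := ⟨fun r m => rfl⟩
  simp [ιInv]

@[simp] theorem ιInv_ι_mul (a : V) (x : TensorAlgebra k V) :
    ιInv (ι k a * x) = algebraMapInv x • a := by
  let : Module kᵐᵒᵖ V := Module.compHom _ ((RingHom.id k).fromOpposite mul_comm)
  have : IsCentralScalar k V := ⟨fun r m => rfl⟩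
  have h : (TrivSqZeroExt.fstHom k k V).comp TensorAlgebra.toTrivSqZeroExt =
      (algebraMapInv : TensorAlgebra k V →ₐ[k] k) := by
    ext a
    simp [algebraMapInv]
  have hx := congrArg (fun φ => φ x) h
  simp only [AlgHom.comp_apply, TrivSqZeroExt.fstHom_apply] at hx
  rw [← hx]
  simp [ιInv]

/-- The counit property of `deconcat`. -/
theorem counit_deconcat (x : TensorAlgebra k V) :
    TensorProduct.lid k _ (TensorProduct.map (algebraMapInv (R := k) (M := V)).toLinearMap
      LinearMap.id (deconcat k V x)) = x := by
  have hz : ∀ a z, TensorProduct.lid k _ (TensorProduct.map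
      (algebraMapInv (R := k) (M := V)).toLinearMap
      LinearMap.id ((ι k a ⊗ₜ[k] (1 : TensorAlgebra k V)) * z)) = 0 := by
    intro a z
    induction z with
    | zero => simp
    | tmul x y => simp
    | add x y hx hy => rw [mul_add, map_add, map_add, hx, hy, add_zero]
  induction x using ι_mul_induction with
  | one => simp [deconcat_one]
  | add x y hx hy => simp only [map_add, hx, hy]
  | smul c x hx => simp only [map_smul, hx]
  | ι_mul a x hx => rw [deconcat_ι_mul, map_add, map_add, hz]; simp

theorem deconcat_counit (x : TensorAlgebra k V) :
    TensorProduct.rid k _ (TensorProduct.map LinearMap.id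
      (algebraMapInv (R := k) (M := V)).toLinearMap (deconcat k V x)) = x := by
  have hz : ∀ (a : V) (z : TensorAlgebra k V ⊗[k] TensorAlgebra k V), TensorProduct.rid k _
      (TensorProduct.map LinearMap.id (algebraMapInv (R := k) (M := V)).toLinearMap
      ((ι k a ⊗ₜ[k] (1 : TensorAlgebra k V)) * z)) = ι k a * TensorProduct.rid k _
        (TensorProduct.map LinearMap.id (algebraMapInv (R := k) (M := V)).toLinearMap z) := by
    intro a z
    induction z with
    | zero => simp
    | tmul x y => simp
    | add x y hx hy => simp only [mul_add, map_add, hx, hy]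
  induction x using ι_mul_induction with
  | one => simp [deconcat_one]
  | add x y hx hy => simp only [map_add, hx, hy]
  | smul c x hx => simp only [map_smul, hx]
  | ι_mul a x hx => rw [deconcat_ι_mul, map_add, map_add, hz, hx]; simp

/-- Split off the first letter of a word. -/
theorem eq_counit_add_first_letter (x : TensorAlgebra k V) :
    x = algebraMap k _ (algebraMapInv x) + LinearMap.mul' k _
      (TensorProduct.map (ι k ∘ₗ ιInv) LinearMap.id (deconcat k V x)) := by
  have hz : ∀ (a : V) (z : TensorAlgebra k V ⊗[k] TensorAlgebra k V), LinearMap.mul' k _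
      (TensorProduct.map (ι k ∘ₗ ιInv) LinearMap.id ((ι k a ⊗ₜ[k] (1 : TensorAlgebra k V)) * z)) =
      ι k a * TensorProduct.lid k _ (TensorProduct.map
        (algebraMapInv (R := k) (M := V)).toLinearMap LinearMap.id z) := by
    intro a z
    induction z with
    | zero => simp
    | tmul x y => simp
    | add x y hx hy => simp only [mul_add, map_add, hx, hy]
  induction x using ι_mul_induction with
  | one => simp [deconcat_one]
  | add x y hx hy =>
    nth_rw 1 [hx, hy]
    simp only [map_add]; abel
  | smul c x hx =>
    nth_rw 1 [hx]
    simp only [map_smul, smul_add, Algebra.algebraMap_eq_smul_one, smul_assoc]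
  | ι_mul a x hx => rw [deconcat_ι_mul, map_add, map_add, hz, counit_deconcat]; simp

end Words

/-! ### Functoriality of the tensor coalgebra. -/

section TensorMap

variable {k : Type v} [Field k] {V : Type u} [AddCommGroup V] [Module k V]
  {W : Type u'} [AddCommGroup W] [Module k W] {U : Type*} [AddCommGroup U] [Module k U]

/-- The map `v₁ ⋯ vₙ ↦ g v₁ ⋯ g vₙ`. -/
def tmap (g : V →ₗ[k] W) : TensorAlgebra k V →ₐ[k] TensorAlgebra k W :=
  TensorAlgebra.lift k (ι k ∘ₗ g)

@[simp] theorem tmap_ι (g : V →ₗ[k] W) (a : V) : tmap g (ι k a) = ι k (g a) := by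
  simp [tmap]

theorem tmap_word (g : V →ₗ[k] W) (l : List V) : tmap g (word k l) = word k (l.map g) := by
  induction l with
  | nil => simp
  | cons a l ih => simp [ih]

theorem tmap_comp (g : W →ₗ[k] U) (f : V →ₗ[k] W) : tmap (g ∘ₗ f) = (tmap g).comp (tmap f) := by
  ext; simp

@[simp] theorem tmap_id : tmap (LinearMap.id : V →ₗ[k] V) = AlgHom.id k _ := by
  ext; simp

theorem algebraMapInv_tmap (g : V →ₗ[k] W) (x : TensorAlgebra k V) :
    algebraMapInv (tmap g x) = algebraMapInv x := by
  have : algebraMapInv.comp (tmap g) = algebraMapInv := by ext; simp [algebraMapInv]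
  exact congrArg (fun φ => φ x) this

theorem ιInv_tmap (g : V →ₗ[k] W) (x : TensorAlgebra k V) :
    ιInv (tmap g x) = g (ιInv x) := by
  have : ιInv ∘ₗ (tmap g).toLinearMap = g ∘ₗ ιInv := by
    refine linearMap_ext_ι_mul (by simp) fun a x _ => ?_
    simp [algebraMapInv_tmap]
  exact congrArg (fun φ => φ x) this

theorem deconcat_tmap (g : V →ₗ[k] W) :
    deconcat k W ∘ₗ (tmap g).toLinearMap =
      TensorProduct.map (tmap g).toLinearMap (tmap g).toLinearMap ∘ₗ deconcat k V := by
  refine linearMap_ext_word fun l => ?_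
  simp [tmap_word, deconcat_word, List.map_take, List.map_drop]

theorem tmap_mem_filt (g : V →ₗ[k] W) {n : ℕ} {x : TensorAlgebra k V} (hx : x ∈ filt k V n) :
    tmap g x ∈ filt k W n := by
  refine filt_le_comap (f := (tmap g).toLinearMap) (fun l hl => ?_) hx
  rw [AlgHom.toLinearMap_apply, tmap_word]
  exact word_mem_filt (by simpa using hl)

end TensorMap

/-! ### Extending a linear map to words in the style of a coderivation. -/

section Twist

variable {k : Type v} [Field k] {V : Type u} [AddCommGroup V] [Module k V]

/-- The action of a letter `a` in the recursion for `twist`: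
`(x, y) ↦ (β a x, g a x + α a y)`. -/
def twistStep (α g β : V →ₗ[k] V) :
    V →ₗ[k] Module.End k (TensorAlgebra k V × TensorAlgebra k V) where
  toFun a := ((LinearMap.mulLeft k (ι k (β a))) ∘ₗ LinearMap.fst k _ _).prod
    ((LinearMap.mulLeft k (ι k (g a))) ∘ₗ LinearMap.fst k _ _ +
      (LinearMap.mulLeft k (ι k (α a))) ∘ₗ LinearMap.snd k _ _)
  map_add' a b := by
    refine LinearMap.ext fun x => Prod.ext ?_ ?_
    · simp [add_mul]
    · simp [add_mul]; abel
  map_smul' c a := by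
    refine LinearMap.ext fun x => Prod.ext ?_ ?_ <;> simp

theorem twistStep_apply (α g β : V →ₗ[k] V) (a : V) (x : TensorAlgebra k V × TensorAlgebra k V) :
    twistStep α g β a x = (ι k (β a) * x.1, ι k (g a) * x.1 + ι k (α a) * x.2) := rfl

/-- The map `∑ᵢ α ⊗ ⋯ ⊗ α ⊗ g ⊗ β ⊗ ⋯ ⊗ β` on words, with `g` in the `i`-th place. -/
def twist (α g β : V →ₗ[k] V) : TensorAlgebra k V →ₗ[k] TensorAlgebra k V :=
  LinearMap.snd k _ _ ∘ₗ LinearMap.applyₗ ((1 : TensorAlgebra k V), (0 : TensorAlgebra k V)) ∘ₗ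
    (TensorAlgebra.lift k (twistStep α g β)).toLinearMap

@[simp] theorem twist_one (α g β : V →ₗ[k] V) : twist α g β 1 = 0 := by
  simp [twist]

@[simp] theorem twist_ι_mul (α g β : V →ₗ[k] V) (a : V) (x : TensorAlgebra k V) :
    twist α g β (ι k a * x) = ι k (g a) * tmap β x + ι k (α a) * twist α g β x := by
  -- The first coordinate of the recursion carries the tail transformed by `β`, ready for the moment
  -- when `g` is applied to the next letter.
  have hfst : ∀ x, (TensorAlgebra.lift k (twistStep α g β) x (1, 0)).1 = tmap β x := by
    intro x
    induction x using ι_mul_induction with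
    | one => simp
    | add x y hx hy => simp [hx, hy]
    | smul c x hx => simp [hx]
    | ι_mul a x hx => simp [twistStep_apply, hx]
  simp [twist, twistStep_apply, hfst]

@[simp] theorem twist_ι (α g β : V →ₗ[k] V) (a : V) : twist α g β (ι k a) = ι k (g a) := by
  simpa using twist_ι_mul α g β a 1

/-- A cut falls either to the right of the letter hit by `g`, leaving only `β`s on its right, or to
the left of it, leaving only `α`s on its left. With `β = id` and `α` the sign this is the
coderivation property of `D`; with `β = i ∘ p` it is the rule for the extended homotopy. -/
theorem deconcat_twist (α g β : V →ₗ[k] V) :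
    deconcat k V ∘ₗ twist α g β =
      (TensorProduct.map (twist α g β) (tmap β).toLinearMap +
        TensorProduct.map (tmap α).toLinearMap (twist α g β)) ∘ₗ deconcat k V := by
  have h1 : ∀ (a : V) z, TensorProduct.map (twist α g β) (tmap β).toLinearMap
      ((ι k a ⊗ₜ[k] (1 : TensorAlgebra k V)) * z) =
      (ι k (g a) ⊗ₜ[k] (1 : TensorAlgebra k V)) *
        TensorProduct.map (tmap β).toLinearMap (tmap β).toLinearMap z +
      (ι k (α a) ⊗ₜ[k] (1 : TensorAlgebra k V)) *
        TensorProduct.map (twist α g β) (tmap β).toLinearMap z := by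
    intro a z
    induction z with
    | zero => simp
    | tmul x y => simp [TensorProduct.add_tmul]
    | add x y hx hy => simp only [mul_add, map_add, hx, hy]; abel
  have h2 : ∀ (a : V) z, TensorProduct.map (tmap α).toLinearMap (twist α g β)
      ((ι k a ⊗ₜ[k] (1 : TensorAlgebra k V)) * z) =
      (ι k (α a) ⊗ₜ[k] (1 : TensorAlgebra k V)) *
        TensorProduct.map (tmap α).toLinearMap (twist α g β) z := by
    intro a z
    induction z with
    | zero => simp
    | tmul x y => simp
    | add x y hx hy => simp only [mul_add, map_add, hx, hy]
  refine linearMap_ext_ι_mul (by simp [deconcat_one]) fun a x hx => ?_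
  have hβ := LinearMap.congr_fun (deconcat_tmap β) x
  simp only [LinearMap.comp_apply, LinearMap.add_apply, AlgHom.toLinearMap_apply] at hx hβ ⊢
  simp only [twist_ι_mul, map_add, deconcat_ι_mul, hx, hβ, h1, h2, TensorProduct.map_tmul,
    twist_one, TensorProduct.zero_tmul, AlgHom.toLinearMap_apply, map_one, mul_add,
    TensorProduct.tmul_add]
  abel

theorem twist_mem_filt (α g β : V →ₗ[k] V) {n : ℕ} {x : TensorAlgebra k V}
    (hx : x ∈ filt k V n) : twist α g β x ∈ filt k V n := by
  refine filt_le_comap (fun l hl => ?_) hx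
  clear hx
  induction l generalizing n with
  | nil => simp
  | cons a l ih =>
    obtain ⟨n, rfl⟩ : ∃ m, n = m + 1 := ⟨n - 1, by simp at hl; omega⟩
    have hl' : l.length < n := by simpa using hl
    rw [word_cons, twist_ι_mul]
    exact add_mem (ι_mul_mem_filt _ (tmap_mem_filt _ (word_mem_filt hl')))
      (ι_mul_mem_filt _ (ih hl'))

theorem ιInv_twist (α g β : V →ₗ[k] V) (x : TensorAlgebra k V) :
    ιInv (twist α g β x) = g (ιInv x) := by
  have hε : ∀ x, algebraMapInv (twist α g β x) = 0 := by
    intro x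
    induction x using ι_mul_induction with
    | one => simp
    | add x y hx hy => simp [hx, hy]
    | smul c x hx => simp [hx]
    | ι_mul a x hx => rw [twist_ι_mul, map_add]; simp only [algebraMapInv_ι_mul, add_zero]
  induction x using ι_mul_induction with
  | one => simp
  | add x y hx hy => simp [hx, hy]
  | smul c x hx => simp [hx]
  | ι_mul a x hx => simp [hε, algebraMapInv_tmap]

end Twist

/-! ### Cofreeness: coalgebra homomorphisms from their corestrictions. -/

section Cofree

variable {k : Type v} [Field k] {V : Type u} [AddCommGroup V] [Module k V]
  {W : Type u'} [AddCommGroup W] [Module k W]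

/-- The map `x ⊗ y ↦ f(x) y`. -/
def firstBlock (f : TensorAlgebra k V →ₗ[k] W) :
    TensorAlgebra k V ⊗[k] TensorAlgebra k W →ₗ[k] TensorAlgebra k W :=
  LinearMap.mul' k _ ∘ₗ TensorProduct.map (ι k ∘ₗ f) LinearMap.id

@[simp] theorem firstBlock_tmul (f : TensorAlgebra k V →ₗ[k] W) (x : TensorAlgebra k V)
    (y : TensorAlgebra k W) : firstBlock f (x ⊗ₜ[k] y) = ι k (f x) * y := by
  simp [firstBlock]

/-- The action of a letter on `x ⊗ y`, where `y` collects finished blocks and `x` is the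
block under construction: prepend the letter to `x`, and either close the block or not. -/
def cofreeStep (f : TensorAlgebra k V →ₗ[k] W) :
    V →ₗ[k] Module.End k (TensorAlgebra k V ⊗[k] TensorAlgebra k W) :=
  LinearMap.mulLeft k (LinearMap.id + TensorProduct.mk k _ _ 1 ∘ₗ firstBlock f) ∘ₗ
    LinearMap.mul k (TensorAlgebra k V ⊗[k] TensorAlgebra k W) ∘ₗ
      (Algebra.TensorProduct.includeLeft (S := k)).toLinearMap ∘ₗ ι k

theorem cofreeStep_apply (f : TensorAlgebra k V →ₗ[k] W) (a : V)
    (z : TensorAlgebra k V ⊗[k] TensorAlgebra k W) :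
    cofreeStep f a z = (ι k a ⊗ₜ[k] 1) * z + 1 ⊗ₜ[k] firstBlock f ((ι k a ⊗ₜ[k] 1) * z) := by
  rfl

/-- The coalgebra homomorphism with corestriction `f`:
`cofree f w = ∑ f(w₁) ⋯ f(wᵣ)` over the ways to cut `w` into nonempty blocks `w = w₁ ⋯ wᵣ`. -/
def cofree (f : TensorAlgebra k V →ₗ[k] W) : TensorAlgebra k V →ₗ[k] TensorAlgebra k W :=
  (TensorProduct.lid k _).toLinearMap ∘ₗ
    TensorProduct.map (algebraMapInv (R := k) (M := V)).toLinearMap LinearMap.id ∘ₗ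
      LinearMap.applyₗ ((1 : TensorAlgebra k V) ⊗ₜ[k] (1 : TensorAlgebra k W)) ∘ₗ
        (TensorAlgebra.lift k (cofreeStep f)).toLinearMap

@[simp] theorem cofree_one (f : TensorAlgebra k V →ₗ[k] W) : cofree f 1 = 1 := by
  simp [cofree]

theorem cofree_ι_mul (f : TensorAlgebra k V →ₗ[k] W) (a : V) (x : TensorAlgebra k V) :
    cofree f (ι k a * x) = firstBlock f ((ι k a ⊗ₜ[k] 1) *
      TensorProduct.map LinearMap.id (cofree f) (deconcat k V x)) := by
  have hz : ∀ (a : V) (z : TensorAlgebra k V ⊗[k] TensorAlgebra k W), TensorProduct.map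
      (algebraMapInv (R := k) (M := V)).toLinearMap LinearMap.id
      ((ι k a ⊗ₜ[k] (1 : TensorAlgebra k W)) * z) = 0 := by
    intro a z
    induction z with
    | zero => simp
    | tmul x y => simp
    | add x y hx hy => rw [mul_add, map_add, hx, hy, add_zero]
  have step : ∀ (a : V) (x : TensorAlgebra k V), cofree f (ι k a * x) =
      firstBlock f ((ι k a ⊗ₜ[k] 1) * TensorAlgebra.lift k (cofreeStep f) x (1 ⊗ₜ[k] 1)) := by
    intro a x
    simp [cofree, cofreeStep_apply, hz]
  have hmul : ∀ (a : V) (z : TensorAlgebra k V ⊗[k] TensorAlgebra k V),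
      TensorProduct.map LinearMap.id (cofree f) ((ι k a ⊗ₜ[k] 1) * z) =
      (ι k a ⊗ₜ[k] 1) * TensorProduct.map LinearMap.id (cofree f) z := by
    intro a z
    induction z with
    | zero => simp
    | tmul x y => simp
    | add x y hx hy => simp only [mul_add, map_add, hx, hy]
  -- Invariant of the recursion: the state after reading `x` from right to left is the sum over all
  -- cuts of `x` of the still open block on the left, tensored with the image of the rest.
  have hG : ∀ x, TensorAlgebra.lift k (cofreeStep f) x (1 ⊗ₜ[k] 1) =
      TensorProduct.map LinearMap.id (cofree f) (deconcat k V x) := by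
    intro x
    induction x using ι_mul_induction with
    | one => simp [deconcat_one]
    | add x y hx hy => simp [hx, hy]
    | smul c x hx => simp [hx]
    | ι_mul a x hx =>
      rw [deconcat_ι_mul, map_add, hmul, ← hx, TensorProduct.map_tmul, step, map_mul,
        TensorAlgebra.lift_ι_apply, Module.End.mul_apply, cofreeStep_apply]
      simp [add_comm]
  rw [step, hG]

theorem cofree_word_cons (f : TensorAlgebra k V →ₗ[k] W) (a : V) (l : List V) :
    cofree f (word k (a :: l)) = ∑ i ∈ Finset.range (l.length + 1),
      ι k (f (word k (a :: l.take i))) * cofree f (word k (l.drop i)) := by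
  rw [word_cons, cofree_ι_mul, deconcat_word, map_sum, Finset.mul_sum, map_sum]
  simp

/-- Both sides enumerate the same data: a cut of the word together with a decomposition of each half
into blocks, since a cut of the image always falls between two blocks. -/
theorem deconcat_cofree (f : TensorAlgebra k V →ₗ[k] W) :
    deconcat k W ∘ₗ cofree f =
      TensorProduct.map (cofree f) (cofree f) ∘ₗ deconcat k V := by
  refine linearMap_ext_word fun l => ?_
  simp only [LinearMap.comp_apply]
  induction hn : l.length using Nat.strong_induction_on generalizing l with
  | _ n ih =>
    subst hn
    cases l with
    | nil => simp [deconcat_one]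
    | cons a l =>
      have h1 : ∀ i ∈ Finset.range (l.length + 1),
          deconcat k W (ι k (f (word k (a :: l.take i))) * cofree f (word k (l.drop i))) =
          1 ⊗ₜ[k] (ι k (f (word k (a :: l.take i))) * cofree f (word k (l.drop i))) +
          ∑ j ∈ Finset.range (l.length + 1 - i),
            (ι k (f (word k (a :: l.take i))) * cofree f (word k ((l.drop i).take j))) ⊗ₜ[k]
              cofree f (word k (l.drop (i + j))) := by
        intro i hi
        have hlen : (l.drop i).length + 1 = l.length + 1 - i := by
          simp at hi ⊢; omega
        have hlt : (l.drop i).length < (a :: l).length := by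
          rw [List.length_drop, List.length_cons]
          omega
        rw [deconcat_ι_mul, ih _ hlt (l.drop i) rfl, deconcat_word, hlen, map_sum,
          Finset.mul_sum]
        simp [List.drop_drop]
      -- The first block is `a` followed by `i` letters, and the cut comes `j` letters after it.
      -- Regrouping the pairs `(i, j)` by `m = i + j` collects the terms with the same cut; the
      -- terms `1 ⊗ _` form the cut before `a`.
      rw [cofree_word_cons, map_sum, Finset.sum_congr rfl h1, Finset.sum_add_distrib,
        ← Finset.sum_range_diag_flip (l.length + 1) (fun i j =>
          (ι k (f (word k (a :: l.take i))) * cofree f (word k ((l.drop i).take j))) ⊗ₜ[k]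
              cofree f (word k (l.drop (i + j)))),
        ← TensorProduct.tmul_sum, ← cofree_word_cons, deconcat_word, map_sum, List.length_cons,
        Finset.sum_range_succ' _ (l.length + 1), add_comm]
      congr 1
      · refine Finset.sum_congr rfl fun m hm => ?_
        have hm' : m ≤ l.length := by simp at hm; omega
        rw [TensorProduct.map_tmul, List.take_succ_cons, List.drop_succ_cons, cofree_word_cons,
          TensorProduct.sum_tmul, List.length_take, min_eq_left hm']
        refine Finset.sum_congr rfl fun i hi => ?_
        have hi' : i ≤ m := by simp at hi; omega
        rw [List.take_take, min_eq_left hi', List.drop_take, Nat.add_sub_cancel' hi']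
      · simp

theorem algebraMapInv_cofree (f : TensorAlgebra k V →ₗ[k] W) (x : TensorAlgebra k V) :
    algebraMapInv (cofree f x) = algebraMapInv x := by
  have : (algebraMapInv (R := k) (M := W)).toLinearMap ∘ₗ cofree f =
      (algebraMapInv (R := k) (M := V)).toLinearMap := by
    refine linearMap_ext_word fun l => ?_
    cases l with
    | nil => simp
    | cons a l =>
      rw [LinearMap.comp_apply, cofree_word_cons, map_sum]
      simp
  exact LinearMap.congr_fun this x

theorem ιInv_cofree {f : TensorAlgebra k V →ₗ[k] W} (hf : f 1 = 0) (x : TensorAlgebra k V) :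
    ιInv (cofree f x) = f x := by
  have : ιInv ∘ₗ cofree f = f := by
    refine linearMap_ext_word fun l => ?_
    cases l with
    | nil => simp [hf]
    | cons a l =>
      rw [LinearMap.comp_apply, cofree_word_cons, map_sum, Finset.sum_eq_single l.length]
      · simp
      · intro i hi hne
        have : l.drop i ≠ [] := by
          simp at hi ⊢; omega
        obtain ⟨b, l', hb⟩ := List.exists_cons_of_ne_nil this
        simp [hb, algebraMapInv_cofree]
      · simp
  exact LinearMap.congr_fun this x

/-- `cofree f` agrees with `f|_V ⊗ ⋯ ⊗ f|_V` up to shorter words. -/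
theorem cofree_sub_tmap_mem_filt (f : TensorAlgebra k V →ₗ[k] W) {n : ℕ} {x : TensorAlgebra k V}
    (hx : x ∈ filt k V (n + 1)) : cofree f x - tmap (f ∘ₗ ι k) x ∈ filt k W n := by
  refine filt_le_comap (f := cofree f - (tmap (f ∘ₗ ι k)).toLinearMap) (fun l hl => ?_) hx
  clear hx
  have key : ∀ (n : ℕ) (l : List V), l.length ≤ n →
      cofree f (word k l) - tmap (f ∘ₗ ι k) (word k l) ∈ filt k W n ∧
        cofree f (word k l) ∈ filt k W (n + 1) := by
    intro n
    induction n with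
    | zero =>
      intro l hl
      have : l = [] := by simpa using hl
      subst this
      simpa using word_mem_filt (k := k) (V := W) (l := []) (n := 1) (by simp)
    | succ n ih =>
      intro l hl
      suffices h : cofree f (word k l) - tmap (f ∘ₗ ι k) (word k l) ∈ filt k W (n + 1) by
        refine ⟨h, ?_⟩
        have := add_mem (filt_mono (Nat.le_succ (n + 1)) h)
          (tmap_mem_filt (f ∘ₗ ι k) (word_mem_filt (k := k) (Nat.lt_succ_of_le hl)))
        rwa [sub_add_cancel] at this
      cases l with
      | nil => simp
      | cons a l =>
        have hl' : l.length ≤ n := by simpa using hl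
        -- The summand `i = 0`, whose first block is the single letter `a`, is compared with `tmap`
        -- by induction; every other first block has at least two letters and so shortens the word.
        rw [cofree_word_cons, Finset.sum_range_succ', add_sub_assoc]
        refine add_mem (sum_mem fun i hi => ?_) ?_
        · have hi' : i < l.length := by simpa using hi
          obtain ⟨n, rfl⟩ : ∃ m, n = m + 1 := ⟨n - 1, by omega⟩
          refine ι_mul_mem_filt _ ?_
          have hlen : (l.drop (i + 1)).length ≤ n := by simp; omega
          have h := add_mem (ih (l.drop (i + 1)) (by omega)).1
            (tmap_mem_filt (f ∘ₗ ι k) (word_mem_filt (k := k) (Nat.lt_succ_of_le hlen)))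
          rwa [sub_add_cancel] at h
        · have : ι k (f (word k (a :: l.take 0))) * cofree f (word k (l.drop 0)) -
              tmap (f ∘ₗ ι k) (word k (a :: l)) =
              ι k (f (ι k a)) * (cofree f (word k l) - tmap (f ∘ₗ ι k) (word k l)) := by
            simp [mul_sub]
          rw [this]
          exact ι_mul_mem_filt _ (ih l hl').1
  exact (key n l (Nat.le_of_lt_succ hl)).1

/-- A counital coalgebra homomorphism into the tensor coalgebra, evaluated on a word. -/
theorem coalgebraHom_word {G : TensorAlgebra k V →ₗ[k] TensorAlgebra k W}
    (hΔ : deconcat k W ∘ₗ G = TensorProduct.map G G ∘ₗ deconcat k V) (l : List V) :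
    G (word k l) = algebraMap k _ (algebraMapInv (G (word k l))) +
      ∑ i ∈ Finset.range (l.length + 1),
        ι k (ιInv (G (word k (l.take i)))) * G (word k (l.drop i)) := by
  have h := eq_counit_add_first_letter (G (word k l))
  have hl := LinearMap.congr_fun hΔ (word k l)
  simp only [LinearMap.comp_apply] at hl
  rw [hl, deconcat_word, map_sum, map_sum, map_sum] at h
  simpa using h

/-- Coalgebra homomorphisms into the tensor coalgebra are determined by their corestrictions. -/
theorem coalgebraHom_ext {F G : TensorAlgebra k V →ₗ[k] TensorAlgebra k W}
    (hF : deconcat k W ∘ₗ F = TensorProduct.map F F ∘ₗ deconcat k V)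
    (hG : deconcat k W ∘ₗ G = TensorProduct.map G G ∘ₗ deconcat k V)
    (hF' : ∀ x, algebraMapInv (F x) = algebraMapInv x)
    (hG' : ∀ x, algebraMapInv (G x) = algebraMapInv x)
    (h : ∀ x, ιInv (F x) = ιInv (G x)) (h1 : ιInv (F 1) = 0) : F = G := by
  refine linearMap_ext_word fun l => ?_
  induction hn : l.length using Nat.strong_induction_on generalizing l with
  | _ n ih =>
    subst hn
    rw [coalgebraHom_word hF, coalgebraHom_word hG, hF', hG']
    congr 1
    refine Finset.sum_congr rfl fun i hi => ?_
    rw [← h]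
    -- The summand with empty first block contains the value on the whole word, so the recursion
    -- would be circular if the corestriction did not vanish on the empty word.
    rcases Nat.eq_zero_or_pos i with rfl | hi0
    · simp [h1]
    · have hlt : (l.drop i).length < l.length := by
        have := Finset.mem_range.1 hi
        rw [List.length_drop]
        omega
      rw [ih _ hlt _ rfl]

end Cofree

/-! ### Twisted coderivations evaluated on words. -/

section Coderivation

variable {k : Type v} [Field k] {V : Type u} [AddCommGroup V] [Module k V]

/-- Applying `ε ⊗ ε`, with `ε` the counit, to the coderivation identity gives `εE = εE + εE`. -/
theorem algebraMapInv_coderivation {α : V →ₗ[k] V}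
    {E : TensorAlgebra k V →ₗ[k] TensorAlgebra k V}
    (hE : deconcat k V ∘ₗ E = (TensorProduct.map E LinearMap.id +
      TensorProduct.map (tmap α).toLinearMap E) ∘ₗ deconcat k V) (x : TensorAlgebra k V) :
    algebraMapInv (E x) = 0 := by
  have h := congrArg (fun z => LinearMap.mul' k k (TensorProduct.map
    (algebraMapInv (R := k) (M := V)).toLinearMap
    (algebraMapInv (R := k) (M := V)).toLinearMap z)) (LinearMap.congr_fun hE x)
  have h1 : ∀ y, LinearMap.mul' k k (TensorProduct.map
      (algebraMapInv (R := k) (M := V)).toLinearMap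
      (algebraMapInv (R := k) (M := V)).toLinearMap (deconcat k V y)) = algebraMapInv y := by
    intro y
    conv_rhs => rw [← counit_deconcat y]
    generalize deconcat k V y = z
    induction z with
    | zero => simp
    | tmul x y => simp
    | add x y hx hy => simp only [map_add, hx, hy]
  have h2 : ∀ y, LinearMap.mul' k k (TensorProduct.map
      (algebraMapInv (R := k) (M := V)).toLinearMap
      (algebraMapInv (R := k) (M := V)).toLinearMap
      (TensorProduct.map (tmap α).toLinearMap E (deconcat k V y))) = algebraMapInv (E y) := by
    intro y
    conv_rhs => rw [← counit_deconcat y]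
    generalize deconcat k V y = z
    induction z with
    | zero => simp
    | tmul x y => simp [algebraMapInv_tmap]
    | add x y hx hy => simp only [map_add, hx, hy]
  have h3 : ∀ y, LinearMap.mul' k k (TensorProduct.map
      (algebraMapInv (R := k) (M := V)).toLinearMap
      (algebraMapInv (R := k) (M := V)).toLinearMap
      (TensorProduct.map E LinearMap.id (deconcat k V y))) = algebraMapInv (E y) := by
    intro y
    conv_rhs => rw [← deconcat_counit y]
    generalize deconcat k V y = z
    induction z with
    | zero => simp
    | tmul x y => simp [mul_comm]
    | add x y hx hy => simp only [map_add, hx, hy]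
  simp only [LinearMap.comp_apply, LinearMap.add_apply, map_add, h1, h2, h3] at h
  simpa using h

theorem coderivation_one {α : V →ₗ[k] V} {E : TensorAlgebra k V →ₗ[k] TensorAlgebra k V}
    (hE : deconcat k V ∘ₗ E = (TensorProduct.map E LinearMap.id +
      TensorProduct.map (tmap α).toLinearMap E) ∘ₗ deconcat k V)
    (h1 : ιInv (E 1) = 0) : E 1 = 0 := by
  have h := eq_counit_add_first_letter (E 1)
  have hl := LinearMap.congr_fun hE 1
  simp only [LinearMap.comp_apply] at hl
  rw [hl, algebraMapInv_coderivation hE, deconcat_one] at h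
  simpa [h1] using h

/-- A coderivation, twisted by `tmap α`, evaluated on a word. -/
theorem coderivation_word_cons {α : V →ₗ[k] V} {E : TensorAlgebra k V →ₗ[k] TensorAlgebra k V}
    (hE : deconcat k V ∘ₗ E = (TensorProduct.map E LinearMap.id +
      TensorProduct.map (tmap α).toLinearMap E) ∘ₗ deconcat k V) (a : V) (l : List V) :
    E (word k (a :: l)) = ∑ i ∈ Finset.range (l.length + 2),
      ι k (ιInv (E (word k ((a :: l).take i)))) * word k ((a :: l).drop i) +
      ι k (α a) * E (word k l) := by
  have hε := algebraMapInv_coderivation hE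
  have h := eq_counit_add_first_letter (E (word k (a :: l)))
  have hl := LinearMap.congr_fun hE (word k (a :: l))
  simp only [LinearMap.comp_apply] at hl
  have h2 : ∀ (z : TensorAlgebra k V ⊗[k] TensorAlgebra k V), LinearMap.mul' k _
      (TensorProduct.map (ι k ∘ₗ ιInv) LinearMap.id (TensorProduct.map (tmap α).toLinearMap E
        ((ι k a ⊗ₜ[k] 1) * z))) = ι k (α a) * E (TensorProduct.lid k _ (TensorProduct.map
          (algebraMapInv (R := k) (M := V)).toLinearMap LinearMap.id z)) := by
    intro z
    induction z with
    | zero => simp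
    | tmul x y => simp [algebraMapInv_tmap]
    | add x y hx hy => simp only [mul_add, map_add, hx, hy]
  rw [hl, hε, LinearMap.add_apply, map_add, map_add, map_zero, zero_add] at h
  rw [h]
  congr 1
  · rw [deconcat_word, map_sum, map_sum, map_sum]
    simp
  · rw [word_cons, deconcat_ι_mul, map_add, map_add, map_add, h2, counit_deconcat]
    simp

end Coderivation

/-! ### Inverting the identity plus an operator that shortens words. -/

section Unipotent

variable {k : Type v} [Field k] {V : Type u} [AddCommGroup V] [Module k V]
  {N : TensorAlgebra k V →ₗ[k] TensorAlgebra k V}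

/-- If `x + N x` lies in `U`, so does `N x + N (N x)`, and `N x` has smaller filtration; induct.
With `U = ⊥` this gives injectivity; with `U` a graded piece it shows that inverting `1 + N`
preserves degrees. -/
theorem mem_of_add_mem_of_lowers (hN : ∀ n, ∀ x ∈ filt k V (n + 1), N x ∈ filt k V n)
    (U : Submodule k (TensorAlgebra k V)) (hU : ∀ x ∈ U, N x ∈ U) (x : TensorAlgebra k V)
    (hx : x + N x ∈ U) : x ∈ U := by
  obtain ⟨n, hn⟩ := exists_mem_filt x
  induction n generalizing x with
  | zero => rw [eq_zero_of_mem_filt_zero hn]; exact U.zero_mem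
  | succ n ih =>
    have h : N x ∈ U := ih (N x) (by simpa using hU _ hx) (hN n x hn)
    simpa using sub_mem hx h

theorem injective_add_of_lowers (hN : ∀ n, ∀ x ∈ filt k V (n + 1), N x ∈ filt k V n) :
    Function.Injective (LinearMap.id + N : TensorAlgebra k V →ₗ[k] TensorAlgebra k V) := by
  rw [injective_iff_map_eq_zero]
  intro x hx
  have := mem_of_add_mem_of_lowers hN ⊥ (by simp) x (by simpa using hx)
  simpa using this

theorem surjective_add_of_lowers (hN : ∀ n, ∀ x ∈ filt k V (n + 1), N x ∈ filt k V n) :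
    Function.Surjective (LinearMap.id + N : TensorAlgebra k V →ₗ[k] TensorAlgebra k V) := by
  intro y
  obtain ⟨n, hn⟩ := exists_mem_filt y
  induction n generalizing y with
  | zero => exact ⟨0, by rw [eq_zero_of_mem_filt_zero hn, map_zero]⟩
  | succ n ih =>
    obtain ⟨z, hz⟩ := ih (N y) (hN n y hn)
    -- Since `(1 + N) z = N y`, subtracting `z` from `y` removes the error term in `(1 + N) y = y +
    -- N y`.
    refine ⟨y - z, ?_⟩
    rw [map_sub, hz]
    simp

end Unipotent

/-! ### Side conditions on letters carried over to words. -/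

section TwistAlgebra

variable {k : Type v} [Field k] {V : Type u} [AddCommGroup V] [Module k V]
  {W : Type u'} [AddCommGroup W] [Module k W]

theorem twist_tmap_eq_zero {α g β : V →ₗ[k] V} {f : W →ₗ[k] V} (h : ∀ x, g (f x) = 0)
    (x : TensorAlgebra k W) : twist α g β (tmap f x) = 0 := by
  induction x using ι_mul_induction with
  | one => simp
  | add x y hx hy => simp [hx, hy]
  | smul c x hx => simp [hx]
  | ι_mul a x hx => simp [hx, h]

theorem tmap_twist_eq_zero {α g β : V →ₗ[k] V} {f : V →ₗ[k] W} (h : ∀ x, f (g x) = 0)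
    (x : TensorAlgebra k V) : tmap f (twist α g β x) = 0 := by
  induction x using ι_mul_induction with
  | one => simp
  | add x y hx hy => simp [hx, hy]
  | smul c x hx => simp [hx]
  | ι_mul a x hx => simp [hx, h]

/-- The coderivation extending an odd differential squares to zero. -/
theorem twist_twist_eq_zero {σ d : V →ₗ[k] V} (hdd : ∀ x, d (d x) = 0)
    (hσd : ∀ x, σ (d x) = -d (σ x)) (x : TensorAlgebra k V) :
    twist σ d LinearMap.id (twist σ d LinearMap.id x) = 0 := by
  induction x using ι_mul_induction with
  | one => simp
  | add x y hx hy => simp [hx, hy]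
  | smul c x hx => simp [hx]
  | ι_mul a x hx => simp [hx, hdd, hσd]

end TwistAlgebra

/-! ### The tensor trick and the homological perturbation of the projection. -/

section Perturbation

variable {k : Type v} [Field k] {V : Type u} [AddCommGroup V] [Module k V]
  {W : Type u'} [AddCommGroup W] [Module k W]

/-- The maps `p` and `i` exhibit `W`, with zero differential, as a deformation retract of the
complex `(V, d)` with homotopy `h`, subject to the usual side conditions; `σ` is the sign
involution of `V`. -/
structure IsRetract (σ d h : V →ₗ[k] V) (p : V →ₗ[k] W) (i : W →ₗ[k] V) : Prop where
  σ_σ : ∀ x, σ (σ x) = x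
  σ_d : ∀ x, σ (d x) = -d (σ x)
  d_d : ∀ x, d (d x) = 0
  homotopy : ∀ x, d (h x) + h (d x) = x - i (p x)
  h_h : ∀ x, h (h x) = 0
  h_i : ∀ x, h (i x) = 0
  p_h : ∀ x, p (h x) = 0
  p_d : ∀ x, p (d x) = 0
  d_i : ∀ x, d (i x) = 0
  p_i : ∀ x, p (i x) = x

namespace IsRetract

variable {σ d h : V →ₗ[k] V} {p : V →ₗ[k] W} {i : W →ₗ[k] V}

/-- When `d` and `h` hit the same letter, `dh + hd = 1 - ip` with `1` on all letters to the left and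
`ip` on all to the right, and the sum telescopes. If `d` hits a letter left of `h`, the two orders
cancel because `σd = -dσ`; if it hits one to the right, it meets `ip` and dies by `di = 0` or `pd =
0`. -/
theorem twist_homotopy (R : IsRetract σ d h p i) (x : TensorAlgebra k V) :
    twist σ d LinearMap.id (twist σ h (i ∘ₗ p) x) +
      twist σ h (i ∘ₗ p) (twist σ d LinearMap.id x) = x - tmap i (tmap p x) := by
  induction x using ι_mul_induction with
  | one => simp
  | add x y hx hy =>
    simp only [map_add]
    rw [add_add_add_comm, hx, hy, add_sub_add_comm]
  | smul c x hx =>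
    simp only [map_smul]
    rw [← smul_add, hx, smul_sub]
  | ι_mul a x hx =>
    have hx' := eq_sub_of_add_eq hx
    have ha := eq_sub_of_add_eq (R.homotopy a)
    simp only [twist_ι_mul, map_add, tmap_comp, AlgHom.comp_apply, tmap_id, AlgHom.id_apply,
      twist_tmap_eq_zero R.d_i, tmap_twist_eq_zero R.p_d, R.σ_σ, R.σ_d, map_mul, tmap_ι, hx', ha,
      map_neg, map_sub, map_zero]
    noncomm_ring

/-- Two copies of `h` on the same letter give `h² = 0`; on different letters, the one further right
meets `ip` from the other factor and dies by `hi = 0` or `ph = 0`. -/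
theorem twist_h_h (R : IsRetract σ d h p i) (x : TensorAlgebra k V) :
    twist σ h (i ∘ₗ p) (twist σ h (i ∘ₗ p) x) = 0 := by
  induction x using ι_mul_induction with
  | one => simp
  | add x y hx hy => simp [hx, hy]
  | smul c x hx => simp [hx]
  | ι_mul a x hx =>
    simp [tmap_comp, hx, R.h_h, twist_tmap_eq_zero R.h_i, tmap_twist_eq_zero R.p_h]

end IsRetract

section

variable {σ d : V →ₗ[k] V} {m : TensorAlgebra k V →ₗ[k] TensorAlgebra k V}

theorem coderivation_sub_twist
    (hm : deconcat k V ∘ₗ m = (TensorProduct.map m LinearMap.id +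
      TensorProduct.map (tmap σ).toLinearMap m) ∘ₗ deconcat k V) :
    deconcat k V ∘ₗ (m - twist σ d LinearMap.id) =
      (TensorProduct.map (m - twist σ d LinearMap.id) LinearMap.id +
        TensorProduct.map (tmap σ).toLinearMap (m - twist σ d LinearMap.id)) ∘ₗ
          deconcat k V := by
  have hid : (AlgHom.id k (TensorAlgebra k V)).toLinearMap = LinearMap.id := rfl
  have := deconcat_twist σ d LinearMap.id
  rw [tmap_id, hid] at this
  rw [LinearMap.comp_sub, hm, this, ← LinearMap.sub_comp]
  congr 1
  rw [sub_eq_add_neg m, TensorProduct.map_add_left, TensorProduct.map_add_right,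
    ← neg_one_smul k (twist σ d LinearMap.id), TensorProduct.map_smul_left,
    TensorProduct.map_smul_right]
  module

/-- The higher operations shorten words. -/
theorem sub_twist_mem_filt
    (hm : deconcat k V ∘ₗ m = (TensorProduct.map m LinearMap.id +
      TensorProduct.map (tmap σ).toLinearMap m) ∘ₗ deconcat k V)
    (h1 : m 1 = 0) (hd : ∀ a, ιInv (m (ι k a)) = d a) (n : ℕ) (x : TensorAlgebra k V)
    (hx : x ∈ filt k V (n + 1)) : (m - twist σ d LinearMap.id) x ∈ filt k V n := by
  refine filt_le_comap (fun l hl => ?_) hx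
  clear hx
  have hμ := coderivation_sub_twist (d := d) hm
  have hμ1 : (m - twist σ d LinearMap.id) 1 = 0 := by simp [h1]
  have hμι : ∀ a, ιInv ((m - twist σ d LinearMap.id) (ι k a)) = 0 := by simp [hd]
  generalize m - twist σ d LinearMap.id = μ at *
  induction l generalizing n with
  | nil => simp [hμ1]
  | cons a l ih =>
    obtain ⟨n, rfl⟩ : ∃ m, n = m + 1 := ⟨n - 1, by simp at hl; omega⟩
    rw [coderivation_word_cons hμ]
    refine add_mem (sum_mem fun j hj => ?_)
      (ι_mul_mem_filt _ (ih n (by simpa using hl)))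
    -- Summand `j` applies the `j`-ary operation to the first `j` letters. It vanishes for `j = 0`
    -- because `m₀ = 0` and for `j = 1` because `d = m₁` was subtracted; from two letters on, the
    -- word becomes shorter.
    match j with
    | 0 => simp [hμ1]
    | 1 => simp [hμι]
    | j + 2 =>
      refine ι_mul_mem_filt _ (word_mem_filt ?_)
      simp at hl hj ⊢
      omega

theorem coderivation_ι
    (hm : deconcat k V ∘ₗ m = (TensorProduct.map m LinearMap.id +
      TensorProduct.map (tmap σ).toLinearMap m) ∘ₗ deconcat k V)
    (h1 : m 1 = 0) (a : V) : m (ι k a) = ι k (ιInv (m (ι k a))) := by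
  have := coderivation_word_cons hm a []
  simpa [Finset.sum_range_succ, h1] using this

end

namespace IsRetract

variable {σ d h : V →ₗ[k] V} {p : V →ₗ[k] W} {i : W →ₗ[k] V}
  {m : TensorAlgebra k V →ₗ[k] TensorAlgebra k V} {q : TensorAlgebra k V →ₗ[k] TensorAlgebra k W}

/-- The hypothesis says `q (1 + μT) = p` for the extended homotopy `T`. Since `T² = 0`, `1 + μT` is
the identity on the image of `T`, so `qT = pT = 0`. -/
theorem lift_h (R : IsRetract σ d h p i)
    (hq : ∀ x, q (x + (m - twist σ d LinearMap.id) (twist σ h (i ∘ₗ p) x)) = tmap p x)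
    (x : TensorAlgebra k V) : q (twist σ h (i ∘ₗ p) x) = 0 := by
  have := hq (twist σ h (i ∘ₗ p) x)
  rwa [R.twist_h_h, map_zero, add_zero, tmap_twist_eq_zero R.p_h] at this

/-- Likewise `Ti = 0`, so `qi = pi = 1`: the inclusion needs no correction to be a section of `q`.
-/
theorem lift_tmap (R : IsRetract σ d h p i)
    (hq : ∀ x, q (x + (m - twist σ d LinearMap.id) (twist σ h (i ∘ₗ p) x)) = tmap p x)
    (x : TensorAlgebra k W) : q (tmap i x) = x := by
  have := hq (tmap i x)
  have hpi : p ∘ₗ i = LinearMap.id := LinearMap.ext R.p_i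
  rwa [twist_tmap_eq_zero R.h_i, map_zero, add_zero, ← AlgHom.comp_apply, ← tmap_comp, hpi,
    tmap_id] at this

/-- The perturbed projection is a coalgebra homomorphism. -/
theorem deconcat_lift (R : IsRetract σ d h p i)
    (hm : deconcat k V ∘ₗ m = (TensorProduct.map m LinearMap.id +
      TensorProduct.map (tmap σ).toLinearMap m) ∘ₗ deconcat k V)
    (hq : ∀ x, q (x + (m - twist σ d LinearMap.id) (twist σ h (i ∘ₗ p) x)) = tmap p x)
    (hs : ∀ x, ∃ y, y + (m - twist σ d LinearMap.id) (twist σ h (i ∘ₗ p) y) = x)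
    {σ' : W →ₗ[k] W} (hqσ : ∀ x, q (tmap σ x) = tmap σ' (q x)) :
    deconcat k W ∘ₗ q = TensorProduct.map q q ∘ₗ deconcat k V := by
  have hqH := R.lift_h hq
  have hqi := R.lift_tmap hq
  have hμ := coderivation_sub_twist (d := d) hm
  have hH := deconcat_twist σ h (i ∘ₗ p)
  have hσσ : (tmap σ).comp (tmap σ) = AlgHom.id k _ := by
    rw [← tmap_comp, show σ ∘ₗ σ = LinearMap.id from LinearMap.ext R.σ_σ, tmap_id]
  generalize m - twist σ d LinearMap.id = μ at *
  generalize hHdef : twist σ h (i ∘ₗ p) = H at *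
  have hμH : ∀ x, q (μ (H x)) = tmap p x - q x := fun x => by rw [← hq x, map_add]; abel
  -- Expand `(μ ⊗ 1 + σ ⊗ μ)(H ⊗ ip + σ ⊗ H)` and apply `q ⊗ q`. The mixed terms die by `qH = 0` and
  -- `qσ = σ'q`. With `qμH = p - q` and `qi = 1` the others give `(p - q) ⊗ p + q ⊗ (p - q)`, which
  -- together with `q ⊗ q` is `p ⊗ p`.
  have key : ∀ z : TensorAlgebra k V ⊗[k] TensorAlgebra k V, TensorProduct.map q q (z +
      (TensorProduct.map μ LinearMap.id (TensorProduct.map H (tmap (i ∘ₗ p)).toLinearMap z +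
          TensorProduct.map (tmap σ).toLinearMap H z) +
        TensorProduct.map (tmap σ).toLinearMap μ (TensorProduct.map H
          (tmap (i ∘ₗ p)).toLinearMap z + TensorProduct.map (tmap σ).toLinearMap H z))) =
      TensorProduct.map (tmap p).toLinearMap (tmap p).toLinearMap z := by
    intro z
    induction z with
    | zero => simp
    | add x y hx hy =>
      rw [map_add (TensorProduct.map (tmap p).toLinearMap (tmap p).toLinearMap), ← hx, ← hy]
      simp only [map_add]
      abel
    | tmul x y =>
      have hσx : tmap σ (tmap σ x) = x := congrArg (fun φ => φ x) hσσ
      simp only [map_add, TensorProduct.map_tmul, LinearMap.id_apply,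
        AlgHom.toLinearMap_apply, hqσ, hqH, hμH, hσx, tmap_comp, AlgHom.comp_apply, hqi,
        map_zero, TensorProduct.zero_tmul, TensorProduct.tmul_zero, TensorProduct.sub_tmul,
        TensorProduct.tmul_sub]
      abel
  refine LinearMap.ext fun x => ?_
  obtain ⟨y, rfl⟩ := hs x
  have h1 := LinearMap.congr_fun hμ (H y)
  have h2 := LinearMap.congr_fun hH y
  have h3 := LinearMap.congr_fun (deconcat_tmap p) y
  simp only [LinearMap.comp_apply, LinearMap.add_apply] at h1 h2 h3 ⊢
  rw [hq, map_add (deconcat k V), h1, h2, key]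
  exact h3

/-- The perturbed projection intertwines `m` with the transferred codifferential `q m i`. -/
theorem lift_comm (R : IsRetract σ d h p i) (hmm : ∀ x, m (m x) = 0)
    (hq : ∀ x, q (x + (m - twist σ d LinearMap.id) (twist σ h (i ∘ₗ p) x)) = tmap p x)
    (hs : ∀ x, ∃ y, y + (m - twist σ d LinearMap.id) (twist σ h (i ∘ₗ p) y) = x)
    (x : TensorAlgebra k V) : q (m (tmap i (q x))) = q (m x) := by
  obtain ⟨y, rfl⟩ := hs x
  rw [hq]
  have hD := R.twist_homotopy y
  have hDi := twist_tmap_eq_zero (α := σ) (β := LinearMap.id) R.d_i (tmap p y)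
  have hpD := tmap_twist_eq_zero (α := σ) (β := LinearMap.id) R.p_d y
  have hDD := twist_twist_eq_zero R.d_d R.σ_d
  generalize twist σ d LinearMap.id = D at *
  generalize twist σ h (i ∘ₗ p) = H at *
  have hqD := hq (D y)
  rw [hpD] at hqD
  have hHD : H (D y) = y - tmap i (tmap p y) - D (H y) := eq_sub_of_add_eq' hD
  -- From `m² = 0`, `D² = 0`, `Di = 0` and the homotopy relation. The right side is `1 + (m - D)H`
  -- applied to `D y`, so `q` sends it to `pD y = 0`.
  have h1 : m (y + (m - D) (H y)) - m (tmap i (tmap p y)) = D y + (m - D) (H (D y)) := by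
    simp only [hHD, LinearMap.sub_apply, map_add, map_sub, hmm, hDD, hDi]
    abel
  rw [← h1, map_sub, sub_eq_zero] at hqD
  exact hqD.symm

end IsRetract

end Perturbation

/-! ### Degrees of letters, words and operators, and Koszul signs. -/

section Degrees

variable {k : Type v} [Field k] {H : ℤ → Type u} [∀ d, AddCommGroup (H d)] [∀ d, Module k (H d)]
  {H' : ℤ → Type u'} [∀ d, AddCommGroup (H' d)] [∀ d, Module k (H' d)]
  {H'' : ℤ → Type*} [∀ d, AddCommGroup (H'' d)] [∀ d, Module k (H'' d)]

variable (k H) in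
/-- The summand of degree `e` of `⨁ d, H d`. -/
def piece (e : ℤ) : Submodule k (⨁ d, H d) := LinearMap.range (DirectSum.lof k ℤ H e)

theorem lof_mem_piece (e : ℤ) (x : H e) : DirectSum.lof k ℤ H e x ∈ piece k H e := ⟨x, rfl⟩

/-- The linear map `g` raises degrees by `r`. -/
def LinDegree (g : (⨁ d, H d) →ₗ[k] ⨁ d, H' d) (r : ℤ) : Prop :=
  ∀ e, ∀ x ∈ piece k H e, g x ∈ piece k H' (e + r)

theorem LinDegree.comp {g : (⨁ d, H' d) →ₗ[k] ⨁ d, H'' d} {f : (⨁ d, H d) →ₗ[k] ⨁ d, H' d}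
    {r s t : ℤ} (hg : LinDegree g r) (hf : LinDegree f s) (h : s + r = t) :
    LinDegree (g ∘ₗ f) t := by
  intro e x hx
  rw [← h, ← add_assoc]
  exact hg _ _ (hf e x hx)

theorem LinDegree.add {g f : (⨁ d, H d) →ₗ[k] ⨁ d, H' d}
    {r : ℤ} (hg : LinDegree g r) (hf : LinDegree f r) : LinDegree (g + f) r :=
  fun e x hx => add_mem (hg e x hx) (hf e x hx)

theorem LinDegree.sub {g f : (⨁ d, H d) →ₗ[k] ⨁ d, H' d}
    {r : ℤ} (hg : LinDegree g r) (hf : LinDegree f r) : LinDegree (g - f) r :=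
  fun e x hx => sub_mem (hg e x hx) (hf e x hx)

theorem LinDegree.id : LinDegree (LinearMap.id : (⨁ d, H d) →ₗ[k] ⨁ d, H d) 0 :=
  fun e x hx => by simpa using hx

theorem linDegree_lmap (g : ∀ d, H d →ₗ[k] H' d) : LinDegree (DirectSum.lmap g) 0 := by
  rintro e _ ⟨x, rfl⟩
  rw [add_zero, DirectSum.lmap_lof]
  exact lof_mem_piece _ _

variable (k H) in
/-- The sign involution `x ↦ (-1)^{|x|} x`. -/
def signMap : (⨁ d, H d) →ₗ[k] ⨁ d, H d :=
  DirectSum.lmap (fun d : ℤ => d.negOnePow • (LinearMap.id : H d →ₗ[k] H d))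

theorem signMap_of_mem_piece {e : ℤ} {x : ⨁ d, H d} (hx : x ∈ piece k H e) :
    signMap k H x = (e.negOnePow : ℤ) • x := by
  obtain ⟨x, rfl⟩ := hx
  rw [signMap, DirectSum.lmap_lof, LinearMap.smul_apply, Units.smul_def, map_zsmul,
    LinearMap.id_apply]

theorem linearMap_ext_piece {M : Type*} [AddCommGroup M] [Module k M]
    {f g : (⨁ d, H d) →ₗ[k] M} (h : ∀ e, ∀ x ∈ piece k H e, f x = g x) : f = g :=
  DirectSum.linearMap_ext _ fun e => LinearMap.ext fun x => h e _ (lof_mem_piece e x)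

theorem signMap_signMap (x : ⨁ d, H d) : signMap k H (signMap k H x) = x := by
  have : signMap k H ∘ₗ signMap k H = LinearMap.id := by
    refine linearMap_ext_piece fun e x hx => ?_
    rw [LinearMap.comp_apply, signMap_of_mem_piece hx, map_zsmul, signMap_of_mem_piece hx,
      smul_smul, ← Units.val_mul]
    simp
  exact LinearMap.congr_fun this x

theorem LinDegree.signMap {g : (⨁ d, H d) →ₗ[k] ⨁ d, H' d} (hg : LinDegree g 1)
    (x : ⨁ d, H d) : signMap k H' (g x) = -g (signMap k H x) := by
  have : AInfinity.signMap k H' ∘ₗ g = -(g ∘ₗ AInfinity.signMap k H) := by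
    refine linearMap_ext_piece fun e x hx => ?_
    rw [LinearMap.comp_apply, signMap_of_mem_piece (hg e x hx), LinearMap.neg_apply,
      LinearMap.comp_apply, signMap_of_mem_piece hx, map_zsmul, Int.negOnePow_succ,
      Units.val_neg, neg_smul]
  exact LinearMap.congr_fun this x

variable (k) in
/-- A word in homogeneous letters. -/
def homWord (l : List (Σ d, H d)) : TensorCoalg k H :=
  word k (l.map fun s => DirectSum.lof k ℤ H s.1 s.2)

/-- The total degree of a word in homogeneous letters. -/
def listDegree {H : ℤ → Type u} (l : List (Σ d, H d)) : ℤ := (l.map Sigma.fst).sum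

theorem homWord_cons (s : Σ d, H d) (l : List (Σ d, H d)) :
    homWord k (s :: l) = ι k (DirectSum.lof k ℤ H s.1 s.2) * homWord k l := by
  simp [homWord]

theorem listDegree_cons {H : ℤ → Type u} (s : Σ d, H d) (l : List (Σ d, H d)) :
    listDegree (s :: l) = s.1 + listDegree l := by
  simp [listDegree]

theorem homWord_mem (l : List (Σ d, H d)) : homWord k l ∈ tensorDegree k H (listDegree l) := by
  refine Submodule.subset_span ⟨l.length, fun i => (l.get i).1, fun i => (l.get i).2, ?_, ?_⟩
  · rw [← List.sum_ofFn, listDegree]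
    congr 1
    exact (List.ofFn_getElem_eq_map l Sigma.fst)
  · rw [TensorAlgebra.tprod_apply, homWord, word, List.map_map]
    congr 1
    exact (List.ofFn_getElem_eq_map l
      (fun s => ι k (DirectSum.lof k ℤ H s.1 s.2))).symm

theorem tensorDegree_eq_span (d : ℤ) : tensorDegree k H d =
    Submodule.span k (homWord k '' {l : List (Σ d, H d) | listDegree l = d}) := by
  apply le_antisymm
  · rw [tensorDegree, Submodule.span_le]
    rintro _ ⟨n, e, o, rfl, rfl⟩
    refine Submodule.subset_span ⟨List.ofFn fun i => ⟨e i, o i⟩, ?_, ?_⟩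
    · simp [listDegree, List.map_ofFn, List.sum_ofFn]
    · rw [TensorAlgebra.tprod_apply, homWord, word, List.map_map, List.map_ofFn]
      rfl
  · rw [Submodule.span_le]
    rintro _ ⟨l, rfl, rfl⟩
    exact homWord_mem l

theorem tensorDegree_le_comap {M : Type*} [AddCommGroup M] [Module k M]
    {E : TensorCoalg k H →ₗ[k] M} {d : ℤ} {U : Submodule k M}
    (h : ∀ l : List (Σ d, H d), listDegree l = d → E (homWord k l) ∈ U)
    {x : TensorCoalg k H} (hx : x ∈ tensorDegree k H d) : E x ∈ U := by
  have : tensorDegree k H d ≤ U.comap E := by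
    rw [tensorDegree_eq_span, Submodule.span_le]
    rintro _ ⟨l, hl, rfl⟩
    exact h l hl
  exact this hx

theorem ι_mul_mem_tensorDegree {e d : ℤ} {a : ⨁ d, H d} (ha : a ∈ piece k H e)
    {x : TensorCoalg k H} (hx : x ∈ tensorDegree k H d) :
    ι k a * x ∈ tensorDegree k H (e + d) := by
  obtain ⟨a, rfl⟩ := ha
  refine tensorDegree_le_comap (E := LinearMap.mulLeft k (ι k (DirectSum.lof k ℤ H e a)))
    (fun l hl => ?_) hx
  have := homWord_mem (k := k) (⟨e, a⟩ :: l)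
  simpa [homWord, listDegree, ← hl] using this

theorem one_mem_tensorDegree : (1 : TensorCoalg k H) ∈ tensorDegree k H 0 :=
  homWord_mem (k := k) (H := H) []

theorem ι_mem_tensorDegree {e : ℤ} {a : ⨁ d, H d} (ha : a ∈ piece k H e) :
    ι k a ∈ tensorDegree k H e := by
  simpa using ι_mul_mem_tensorDegree ha one_mem_tensorDegree

theorem ιInv_mem_piece {d : ℤ} {x : TensorCoalg k H} (hx : x ∈ tensorDegree k H d) :
    ιInv x ∈ piece k H d := by
  refine tensorDegree_le_comap (fun l hl => ?_) hx
  match l with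
  | [] => simp [homWord]
  | [s] =>
    obtain rfl : s.1 = d := by simpa [listDegree] using hl
    simpa [homWord] using lof_mem_piece s.1 s.2
  | s :: t :: l => simp [homWord]

theorem iSup_tensorDegree : ⨆ d, tensorDegree k H d = ⊤ := by
  rw [eq_top_iff]
  rintro x -
  induction x using ι_mul_induction with
  | one => exact Submodule.mem_iSup_of_mem 0 one_mem_tensorDegree
  | add x y hx hy => exact add_mem (hx) (hy)
  | smul c x hx => exact Submodule.smul_mem _ c (hx)
  | ι_mul a x hx =>
    induction a using DirectSum.induction_on with
    | zero => simp
    | add a b ha hb => rw [map_add, add_mul]; exact add_mem ha hb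
    | of e a =>
      refine Submodule.iSup_induction (p := tensorDegree k H) (motive := fun x =>
        ι k (DirectSum.of H e a) * x ∈ ⨆ d, tensorDegree k H d) hx (fun d x hx => ?_)
        (by simp) (fun x y hx hy => by rw [mul_add]; exact add_mem hx hy)
      exact Submodule.mem_iSup_of_mem (e + d)
        (ι_mul_mem_tensorDegree (lof_mem_piece (k := k) e a) hx)

theorem linearMap_ext_tensorDegree {M : Type*} [AddCommGroup M] [Module k M]
    {f g : TensorCoalg k H →ₗ[k] M} (h : ∀ d, ∀ x ∈ tensorDegree k H d, f x = g x) : f = g := by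
  have : ⨆ d, tensorDegree k H d ≤ LinearMap.eqLocus f g := iSup_le fun d x hx => h d x hx
  rw [iSup_tensorDegree] at this
  exact LinearMap.ext fun x => this trivial

theorem koszulSign_eq : koszulSign k H = (tmap (signMap k H)).toLinearMap := rfl

theorem koszulSign_of_mem {d : ℤ} {x : TensorCoalg k H} (hx : x ∈ tensorDegree k H d) :
    tmap (signMap k H) x = (d.negOnePow : ℤ) • x := by
  have key : ∀ l : List (Σ d, H d), tmap (signMap k H) (homWord k l) =
      ((listDegree l).negOnePow : ℤ) • homWord k l := by
    intro l
    induction l with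
    | nil => simp [homWord, listDegree]
    | cons s l ih =>
      rw [homWord_cons, listDegree_cons, map_mul, ih, tmap_ι, signMap_of_mem_piece (lof_mem_piece _ _), map_zsmul,
        Int.negOnePow_add, Units.val_mul, smul_mul_smul_comm]
  have := tensorDegree_le_comap (E := (tmap (signMap k H)).toLinearMap -
    (d.negOnePow : ℤ) • LinearMap.id) (U := ⊥) (fun l hl => by
      rw [LinearMap.sub_apply, LinearMap.smul_apply, AlgHom.toLinearMap_apply, key, hl]
      exact sub_self _) hx
  exact sub_eq_zero.1 this

/-- The linear map `E` between tensor coalgebras raises degrees by `r`. -/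
def HasDegree (E : TensorCoalg k H →ₗ[k] TensorCoalg k H') (r : ℤ) : Prop :=
  ∀ d, ∀ x ∈ tensorDegree k H d, E x ∈ tensorDegree k H' (d + r)

theorem HasDegree.comp {E : TensorCoalg k H' →ₗ[k] TensorCoalg k H''}
    {F : TensorCoalg k H →ₗ[k] TensorCoalg k H'} {r s t : ℤ} (hE : HasDegree E r)
    (hF : HasDegree F s) (h : s + r = t) : HasDegree (E ∘ₗ F) t := by
  intro d x hx
  rw [← h, ← add_assoc]
  exact hE _ _ (hF d x hx)

theorem HasDegree.sub {E F : TensorCoalg k H →ₗ[k] TensorCoalg k H'} {r : ℤ}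
    (hE : HasDegree E r) (hF : HasDegree F r) : HasDegree (E - F) r :=
  fun d x hx => sub_mem (hE d x hx) (hF d x hx)

/-- The sign acts on each graded piece as a scalar depending only on the degree, and the pieces
span. This moves degree zero coalgebra maps past the sign in the coderivation rule. -/
theorem HasDegree.koszulSign {E : TensorCoalg k H →ₗ[k] TensorCoalg k H'} (hE : HasDegree E 0)
    (x : TensorCoalg k H) : E (tmap (signMap k H) x) = tmap (signMap k H') (E x) := by
  have : E ∘ₗ (tmap (signMap k H)).toLinearMap = (tmap (signMap k H')).toLinearMap ∘ₗ E := by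
    refine linearMap_ext_tensorDegree fun d x hx => ?_
    have h := hE d x hx
    rw [add_zero] at h
    simp only [LinearMap.comp_apply, AlgHom.toLinearMap_apply]
    rw [koszulSign_of_mem hx, koszulSign_of_mem h, map_zsmul]
  exact LinearMap.congr_fun this x

theorem hasDegree_of_homWord {E : TensorCoalg k H →ₗ[k] TensorCoalg k H'} {r : ℤ}
    (h : ∀ l : List (Σ d, H d), E (homWord k l) ∈ tensorDegree k H' (listDegree l + r)) :
    HasDegree E r :=
  fun _ _ hx => tensorDegree_le_comap (fun l hl => hl ▸ h l) hx

theorem hasDegree_tmap {g : (⨁ d, H d) →ₗ[k] ⨁ d, H' d} (hg : LinDegree g 0) :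
    HasDegree (tmap g).toLinearMap 0 := by
  refine hasDegree_of_homWord fun l => ?_
  rw [AlgHom.toLinearMap_apply]
  induction l with
  | nil => simpa [homWord, listDegree] using one_mem_tensorDegree (k := k) (H := H')
  | cons s l ih =>
    rw [homWord_cons, listDegree_cons, map_mul, tmap_ι, add_assoc]
    refine ι_mul_mem_tensorDegree ?_ ih
    simpa using hg _ _ (lof_mem_piece s.1 s.2)

theorem hasDegree_twist {α g β : (⨁ d, H d) →ₗ[k] ⨁ d, H d} {r : ℤ} (hα : LinDegree α 0)
    (hg : LinDegree g r) (hβ : LinDegree β 0) : HasDegree (twist α g β) r := by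
  refine hasDegree_of_homWord fun l => ?_
  induction l with
  | nil => simp [homWord]
  | cons s l ih =>
    rw [homWord_cons, listDegree_cons, twist_ι_mul]
    refine add_mem ?_ ?_
    · have := ι_mul_mem_tensorDegree (hg _ _ (lof_mem_piece s.1 s.2))
        (hasDegree_tmap hβ _ _ (homWord_mem l))
      rwa [show s.1 + listDegree l + r = s.1 + r + (listDegree l + 0) by ring]
    · have := ι_mul_mem_tensorDegree (hα _ _ (lof_mem_piece s.1 s.2)) ih
      rwa [show s.1 + listDegree l + r = s.1 + 0 + (listDegree l + r) by ring]

theorem hasDegree_cofree {f : TensorCoalg k H →ₗ[k] ⨁ d, H' d}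
    (hf : ∀ d, ∀ x ∈ tensorDegree k H d, f x ∈ piece k H' d) : HasDegree (cofree f) 0 := by
  refine hasDegree_of_homWord fun l => ?_
  rw [add_zero]
  induction hn : l.length using Nat.strong_induction_on generalizing l with
  | _ n ih =>
    subst hn
    cases l with
    | nil => simpa [homWord, listDegree] using one_mem_tensorDegree (k := k) (H := H')
    | cons s l =>
      rw [homWord, List.map_cons, cofree_word_cons]
      refine sum_mem fun i _ => ?_
      rw [← List.map_take, ← List.map_drop, ← List.map_cons
        (f := fun s : Σ d, H d => DirectSum.lof k ℤ H s.1 s.2)]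
      have hlt : (l.drop i).length < (s :: l).length := by
        rw [List.length_drop, List.length_cons]
        omega
      have := ι_mul_mem_tensorDegree (hf _ _ (homWord_mem (s :: l.take i)))
        (ih _ hlt (l.drop i) rfl)
      have hdeg : listDegree (s :: l) = listDegree (s :: l.take i) + listDegree (l.drop i) := by
        rw [listDegree, listDegree, listDegree, ← List.sum_append, ← List.map_append,
          List.cons_append, List.take_append_drop]
      rw [hdeg]
      exact this

end Degrees

/-! ### Splitting a graded complex over a field. -/

section Splitting

variable {k : Type v} [Field k]

/-- Project the target onto the range of `f`, then apply a section of `f` over its range. -/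
theorem exists_generalizedInverse {U : Type*} [AddCommGroup U] [Module k U]
    {W : Type*} [AddCommGroup W] [Module k W] (f : U →ₗ[k] W) :
    ∃ g : W →ₗ[k] U, ∀ x, f (g (f x)) = f x := by
  obtain ⟨s, hs⟩ := f.rangeRestrict.exists_rightInverse_of_surjective f.range_rangeRestrict
  obtain ⟨t, ht⟩ := (LinearMap.range f).subtype.exists_leftInverse_of_injective
    (Submodule.ker_subtype _)
  refine ⟨s ∘ₗ t, fun x => ?_⟩
  have h1 : t (f x) = f.rangeRestrict x := LinearMap.congr_fun ht (f.rangeRestrict x)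
  have h2 := LinearMap.congr_fun hs (f.rangeRestrict x)
  rw [LinearMap.comp_apply, h1]
  exact congrArg Subtype.val h2

variable {H : ℤ → Type u} [∀ d, AddCommGroup (H d)] [∀ d, Module k (H d)]

theorem exists_graded_generalizedInverse {d : (⨁ d, H d) →ₗ[k] ⨁ d, H d} (hd : LinDegree d 1) :
    ∃ h : (⨁ d, H d) →ₗ[k] ⨁ d, H d, LinDegree h (-1) ∧ ∀ x, d (h (d x)) = d x := by
  -- Indexing by the target degree `e` makes the inverse land in degree `e - 1` on the nose, with no
  -- transport between summands.
  choose g hg using fun e : ℤ => exists_generalizedInverse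
    (DirectSum.component k ℤ H e ∘ₗ d ∘ₗ DirectSum.lof k ℤ H (e - 1))
  have hd' : ∀ e (x : H (e - 1)), d (DirectSum.lof k ℤ H (e - 1) x) =
      DirectSum.lof k ℤ H e (DirectSum.component k ℤ H e (d (DirectSum.lof k ℤ H (e - 1) x))) := by
    intro e x
    have := hd _ _ (lof_mem_piece (k := k) (e - 1) x)
    rw [sub_add_cancel] at this
    obtain ⟨y, hy⟩ := this
    rw [← hy, DirectSum.component.lof_self]
  refine ⟨DirectSum.toModule k ℤ _ fun e => DirectSum.lof k ℤ H (e - 1) ∘ₗ g e, ?_, ?_⟩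
  · rintro e _ ⟨x, rfl⟩
    rw [DirectSum.toModule_lof]
    exact lof_mem_piece (k := k) (e - 1) _
  · intro x
    suffices h : d ∘ₗ (DirectSum.toModule k ℤ _ fun e =>
        DirectSum.lof k ℤ H (e - 1) ∘ₗ g e) ∘ₗ d = d from LinearMap.congr_fun h x
    refine linearMap_ext_piece fun e x hx => ?_
    obtain ⟨e, rfl⟩ : ∃ e', e = e' - 1 := ⟨e + 1, by ring⟩
    obtain ⟨x, rfl⟩ := hx
    rw [LinearMap.comp_apply, LinearMap.comp_apply, hd' e x, DirectSum.toModule_lof,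
      LinearMap.comp_apply, hd' e]
    congr 1
    exact hg e x

/-- A differential over a field admits a homotopy `h` with `dhd = d`, `hdh = h`, `h² = 0`. -/
theorem exists_homotopy {d : (⨁ d, H d) →ₗ[k] ⨁ d, H d} (hd : LinDegree d 1)
    (hdd : d ∘ₗ d = 0) :
    ∃ h : (⨁ d, H d) →ₗ[k] ⨁ d, H d, LinDegree h (-1) ∧ d ∘ₗ h ∘ₗ d = d ∧
      h ∘ₗ d ∘ₗ h = h ∧ h ∘ₗ h = 0 := by
  obtain ⟨g, hg, hdgd⟩ := exists_graded_generalizedInverse hd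
  have hdd' : ∀ x, d (d x) = 0 := LinearMap.congr_fun hdd
  have h1deg : LinDegree (g ∘ₗ d ∘ₗ g) (-1) := hg.comp (hd.comp hg rfl) rfl
  -- The map `h₁ = gdg` already satisfies `dh₁d = d` and `h₁dh₁ = h₁`. Subtracting `dh₁²` keeps both
  -- identities, as `d² = 0`, and makes the square vanish.
  refine ⟨g ∘ₗ d ∘ₗ g - d ∘ₗ (g ∘ₗ d ∘ₗ g) ∘ₗ (g ∘ₗ d ∘ₗ g),
    h1deg.sub (hd.comp (h1deg.comp h1deg rfl) rfl), ?_, ?_, ?_⟩ <;>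
  · ext1 e
    ext1 x
    simp [hdd', hdgd]

/-- Graded idempotents split. -/
theorem exists_split_idempotent {P : (⨁ d, H d) →ₗ[k] ⨁ d, H d} (hP : LinDegree P 0)
    (hPP : ∀ x, P (P x) = P x) :
    ∃ (A : ℤ → Type u) (_ : ∀ d, AddCommGroup (A d)) (_ : ∀ d, Module k (A d))
      (p : (⨁ d, H d) →ₗ[k] ⨁ d, A d) (i : (⨁ d, A d) →ₗ[k] ⨁ d, H d),
      LinDegree p 0 ∧ LinDegree i 0 ∧ (∀ x, p (i x) = x) ∧ ∀ x, i (p x) = P x := by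
  let Q : ∀ e, H e →ₗ[k] H e := fun e =>
    DirectSum.component k ℤ H e ∘ₗ P ∘ₗ DirectSum.lof k ℤ H e
  have hQ : ∀ e x, P (DirectSum.lof k ℤ H e x) = DirectSum.lof k ℤ H e (Q e x) := by
    intro e x
    have := hP _ _ (lof_mem_piece (k := k) e x)
    rw [add_zero] at this
    obtain ⟨y, hy⟩ := this
    simp only [Q, LinearMap.comp_apply]
    rw [← hy, DirectSum.component.lof_self]
  have hQQ : ∀ e x, Q e (Q e x) = Q e x := by
    intro e x
    have := hPP (DirectSum.lof k ℤ H e x)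
    rw [hQ, hQ] at this
    simpa only [DirectSum.component.lof_self] using congrArg (DirectSum.component k ℤ H e) this
  refine ⟨fun e => LinearMap.range (Q e), fun e => inferInstance, fun e => inferInstance,
    DirectSum.lmap fun e => (Q e).rangeRestrict,
    DirectSum.lmap fun e => (LinearMap.range (Q e)).subtype,
    linDegree_lmap _, linDegree_lmap _, fun x => ?_, fun x => ?_⟩
  · rw [← LinearMap.comp_apply, ← DirectSum.lmap_comp]
    convert LinearMap.id_apply (R := k) x
    rw [← DirectSum.lmap_id]
    congr 1
    funext e
    ext ⟨_, y, rfl⟩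
    exact hQQ e y
  · rw [← LinearMap.comp_apply, ← DirectSum.lmap_comp]
    congr 1
    refine linearMap_ext_piece ?_
    rintro e _ ⟨x, rfl⟩
    rw [DirectSum.lmap_lof, hQ]
    rfl

end Splitting

/-! ### Building and transporting `A∞`-structures. -/

section Structures

variable {k : Type v} [Field k] {H : ℤ → Type u} [∀ d, AddCommGroup (H d)] [∀ d, Module k (H d)]
  {H' : ℤ → Type u'} [∀ d, AddCommGroup (H' d)] [∀ d, Module k (H' d)]

theorem component_apply (F : TensorCoalg k H →ₗ[k] TensorCoalg k H') (n : ℕ)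
    (o : Fin n → ⨁ d, H d) : component F n o = ιInv (F (word k (List.ofFn o))) := by
  simp only [component, LinearMap.compMultilinearMap_apply, LinearMap.comp_apply,
    TensorAlgebra.tprod_apply, word, List.map_ofFn]
  rfl

theorem component_zero_eq_zero {F : TensorCoalg k H →ₗ[k] TensorCoalg k H'}
    (h : ιInv (F 1) = 0) : component F 0 = 0 := by
  refine MultilinearMap.ext fun o => ?_
  rw [component_apply]
  simpa using h

theorem component_one_apply (F : TensorCoalg k H →ₗ[k] TensorCoalg k H') (x : ⨁ d, H d) :
    component F 1 (fun _ => x) = ιInv (F (ι k x)) := by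
  simp [component_apply]

namespace AInfinityAlgebra

theorem codiff_one (X : AInfinityAlgebra k H) : X.codiff 1 = 0 := by
  refine coderivation_one (α := signMap k H) X.coderivation ?_
  have := congrArg (fun f => f (fun _ => 0)) X.component_zero
  simpa [component_apply] using this

/-- The `A∞`-structure `c` induced along a surjective coalgebra homomorphism `G`. -/
def push (X : AInfinityAlgebra k H) (G : TensorCoalg k H →ₗ[k] TensorCoalg k H')
    (c : TensorCoalg k H' →ₗ[k] TensorCoalg k H') (hG : HasDegree G 0) (hc : HasDegree c 1)
    (hΔ : deconcat k (⨁ d, H' d) ∘ₗ G = TensorProduct.map G G ∘ₗ deconcat k (⨁ d, H d))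
    (hG1 : G 1 = 1) (hs : Function.Surjective G) (hcG : ∀ x, c (G x) = G (X.codiff x)) :
    AInfinityAlgebra k H' where
  codiff := c
  degree_one := hc
  coderivation := by
    -- As `G` is surjective, the coderivation rule may be checked after composing with `G`, where it
    -- follows from the rule on `H`; the sign passes through `G` because `G` has degree zero.
    have key : ∀ z, TensorProduct.map c LinearMap.id (TensorProduct.map G G z) +
        TensorProduct.map (koszulSign k H') c (TensorProduct.map G G z) =
        TensorProduct.map G G (TensorProduct.map X.codiff LinearMap.id z +
          TensorProduct.map (koszulSign k H) X.codiff z) := by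
      intro z
      induction z with
      | zero => simp only [map_zero, add_zero]
      | add x y hx hy =>
        simp only [map_add] at hx hy ⊢
        rw [add_add_add_comm, hx, hy, add_add_add_comm]
      | tmul x y =>
        simp only [TensorProduct.map_tmul, LinearMap.id_apply, map_add, hcG,
          koszulSign_eq, AlgHom.toLinearMap_apply, hG.koszulSign]
    refine LinearMap.ext fun y => ?_
    obtain ⟨x, rfl⟩ := hs y
    have h1 := LinearMap.congr_fun hΔ (X.codiff x)
    have h2 := LinearMap.congr_fun hΔ x
    have h3 := LinearMap.congr_fun X.coderivation x
    rw [LinearMap.comp_apply, LinearMap.comp_apply] at h1 h2 h3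
    rw [LinearMap.comp_apply, LinearMap.comp_apply, hcG, h1, h2, h3, LinearMap.add_apply,
      LinearMap.add_apply, key]
  sq_zero := by
    refine LinearMap.ext fun y => ?_
    obtain ⟨x, rfl⟩ := hs y
    have := LinearMap.congr_fun X.sq_zero x
    rw [LinearMap.comp_apply] at this
    rw [LinearMap.comp_apply, hcG, hcG, this]
    simp
  component_zero := component_zero_eq_zero (by rw [← hG1, hcG, X.codiff_one]; simp)

/-- A complex as an `A∞`-algebra without higher operations. -/
def ofDifferential (d : (⨁ d, H d) →ₗ[k] ⨁ d, H d) (hd : LinDegree d 1)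
    (hdd : ∀ x, d (d x) = 0) : AInfinityAlgebra k H where
  codiff := twist (signMap k H) d LinearMap.id
  degree_one := hasDegree_twist (linDegree_lmap _) hd LinDegree.id
  coderivation := by
    have := deconcat_twist (signMap k H) d LinearMap.id
    rwa [tmap_id] at this
  sq_zero := LinearMap.ext fun x => twist_twist_eq_zero hdd hd.signMap x
  component_zero := component_zero_eq_zero (by simp)

theorem ofDifferential_m {d : (⨁ d, H d) →ₗ[k] ⨁ d, H d} (hd : LinDegree d 1)
    (hdd : ∀ x, d (d x) = 0) (n : ℕ) (o : Fin n → ⨁ d, H d) :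
    (ofDifferential d hd hdd).m n o = d (ιInv (word k (List.ofFn o))) := by
  rw [m, component_apply]
  exact ιInv_twist _ _ _ _

/-- The differential `m₁`. -/
def differential (X : AInfinityAlgebra k H) : (⨁ d, H d) →ₗ[k] ⨁ d, H d :=
  ιInv ∘ₗ X.codiff ∘ₗ ι k

theorem codiff_ι (X : AInfinityAlgebra k H) (a : ⨁ d, H d) :
    X.codiff (ι k a) = ι k (X.differential a) :=
  coderivation_ι (σ := signMap k H) X.coderivation X.codiff_one a

theorem codiff_codiff (X : AInfinityAlgebra k H) (x : TensorCoalg k H) :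
    X.codiff (X.codiff x) = 0 :=
  LinearMap.congr_fun X.sq_zero x

theorem differential_differential (X : AInfinityAlgebra k H) (a : ⨁ d, H d) :
    X.differential (X.differential a) = 0 := by
  have := X.codiff_codiff (ι k a)
  rw [codiff_ι, codiff_ι] at this
  simpa using this

theorem linDegree_differential (X : AInfinityAlgebra k H) : LinDegree X.differential 1 :=
  fun _ _ hx => ιInv_mem_piece (X.degree_one _ _ (ι_mem_tensorDegree hx))

end AInfinityAlgebra

end Structures

/-! ### The minimal model and the decomposition. -/

section Decomposition

variable {k : Type v} [Field k] {H : ℤ → Type u} [∀ d, AddCommGroup (H d)] [∀ d, Module k (H d)]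
  {A : ℤ → Type u'} [∀ d, AddCommGroup (A d)] [∀ d, Module k (A d)]

/-- Homotopy transfer: a deformation retract `A` of the complex of `X` with zero differential
carries a minimal `A∞`-structure, and the projection extends to an `A∞`-morphism. -/
theorem exists_minimal_model (X : AInfinityAlgebra k H) {h : (⨁ d, H d) →ₗ[k] ⨁ d, H d}
    {p : (⨁ d, H d) →ₗ[k] ⨁ d, A d} {i : (⨁ d, A d) →ₗ[k] ⨁ d, H d}
    (R : IsRetract (signMap k H) X.differential h p i) (hh : LinDegree h (-1))
    (hp : LinDegree p 0) (hi : LinDegree i 0) :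
    ∃ (M : AInfinityAlgebra k A) (q : AInfinityMorphism X M), M.IsMinimal ∧
      ∀ a, q.toLinearMap (ι k a) = ι k (p a) := by
  set D := twist (signMap k H) X.differential LinearMap.id with hD
  set T := twist (signMap k H) h (i ∘ₗ p) with hT
  have hμ := sub_twist_mem_filt (σ := signMap k H) X.coderivation X.codiff_one
    (d := X.differential) (fun a => rfl)
  have hN : ∀ n, ∀ x ∈ filt k (⨁ d, H d) (n + 1),
      ((X.codiff - D) ∘ₗ T) x ∈ filt k (⨁ d, H d) n :=
    fun n x hx => hμ n _ (twist_mem_filt _ _ _ hx)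
  let e := LinearEquiv.ofBijective _ ⟨injective_add_of_lowers hN, surjective_add_of_lowers hN⟩
  have he : ∀ x, e x = x + (X.codiff - D) (T x) := fun x => rfl
  have hs : ∀ x, ∃ y, y + (X.codiff - D) (T y) = x := fun x => e.surjective x
  have hNdeg : HasDegree ((X.codiff - D) ∘ₗ T) 0 :=
    HasDegree.comp (HasDegree.sub X.degree_one
      (hasDegree_twist (linDegree_lmap _) X.linDegree_differential LinDegree.id))
      (hasDegree_twist (linDegree_lmap _) hh (hi.comp hp rfl)) rfl
  let q : TensorCoalg k H →ₗ[k] TensorCoalg k A := (tmap p).toLinearMap ∘ₗ e.symm.toLinearMap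
  have hq : ∀ x, q (x + (X.codiff - D) (T x)) = tmap p x := by
    intro x
    rw [← he]
    simp [q]
  -- `1 + μT` preserves degrees, and by local nilpotence of `μT` so does its inverse.
  have hqdeg : HasDegree q 0 := by
    intro d x hx
    obtain ⟨y, rfl⟩ := hs x
    rw [hq]
    refine hasDegree_tmap hp d y (mem_of_add_mem_of_lowers hN (tensorDegree k H d)
      (fun x hx => ?_) y hx)
    simpa using hNdeg d x hx
  have hqΔ := R.deconcat_lift X.coderivation hq hs hqdeg.koszulSign
  have hqi := R.lift_tmap hq
  have hcomm := R.lift_comm X.codiff_codiff hq hs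
  have hq1 : q 1 = 1 := by simpa [hT] using hq 1
  have hqι : ∀ a, q (ι k a) = ι k (p a) := by
    intro a
    have := hq (ι k a)
    simpa [hT, hD, X.codiff_ι] using this
  let M : AInfinityAlgebra k A := X.push q (q ∘ₗ X.codiff ∘ₗ (tmap i).toLinearMap) hqdeg
    (hqdeg.comp (HasDegree.comp X.degree_one (hasDegree_tmap hi) rfl) rfl) hqΔ hq1
    (fun y => ⟨tmap i y, hqi y⟩) hcomm
  refine ⟨M, ⟨q, fun d x hx => by simpa using hqdeg d x hx, ?_, hqΔ,
    LinearMap.ext fun x => (hcomm x).symm, component_zero_eq_zero (by simp [hq1])⟩, ?_, hqι⟩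
  · intro x
    obtain ⟨y, rfl⟩ := hs x
    have hε : ∀ z, algebraMapInv ((X.codiff - D) z) = 0 :=
      algebraMapInv_coderivation (coderivation_sub_twist (σ := signMap k H) X.coderivation)
    rw [hq, algebraMapInv_tmap, map_add, hε, add_zero]
  -- On letters the transferred codifferential is `q𝔪i`, and `𝔪` acts on a letter by `m₁`, which
  -- vanishes on the image of `i`.
  · refine MultilinearMap.ext fun o => ?_
    have : (X.codiff (tmap i (ι k (o 0)))) = 0 := by
      rw [tmap_ι, X.codiff_ι, R.d_i, map_zero]
    simp only [AInfinityAlgebra.m, component_apply, List.ofFn_succ, List.ofFn_zero, word_cons,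
      word_nil, mul_one]
    change ιInv (q (X.codiff (tmap i (ι k (o 0))))) = 0
    rw [this, map_zero, map_zero]

variable {B : ℤ → Type u'} [∀ d, AddCommGroup (B d)] [∀ d, Module k (B d)]

/-- A splitting of the complex of `X` into a part `A` with zero differential and a contractible
part `B` lifts to a decomposition of `X`. -/
theorem exists_decomposition_of_splitting (X : AInfinityAlgebra k H)
    {h : (⨁ d, H d) →ₗ[k] ⨁ d, H d}
    {p : (⨁ d, H d) →ₗ[k] ⨁ d, A d} {i : (⨁ d, A d) →ₗ[k] ⨁ d, H d}
    {b : (⨁ d, H d) →ₗ[k] ⨁ d, B d} {j : (⨁ d, B d) →ₗ[k] ⨁ d, H d}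
    (R : IsRetract (signMap k H) X.differential h p i) (hh : LinDegree h (-1))
    (hp : LinDegree p 0) (hi : LinDegree i 0) (hb : LinDegree b 0) (hj : LinDegree j 0)
    (hdhd : ∀ x, X.differential (h (X.differential x)) = X.differential x)
    (hbj : ∀ x, b (j x) = x)
    (hjb : ∀ x, j (b x) = X.differential (h x) + h (X.differential x)) :
    ∃ (M : AInfinityAlgebra k A) (L : AInfinityAlgebra k B)
      (S : AInfinityAlgebra k (fun d => A d × B d)),
      M.IsMinimal ∧ L.IsLinearContractible ∧ S.IsDirectSum M L ∧
        ∃ F : AInfinityMorphism X S, F.IsIso := by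
  obtain ⟨M, q, hM, hqι⟩ := exists_minimal_model X R hh hp hi
  have hdd := X.differential_differential
  have hddeg := X.linDegree_differential
  have hd_def : ∀ a, ιInv (X.codiff (ι k a)) = X.differential a := fun a => rfl
  generalize X.differential = d at *
  -- The two summands are orthogonal: `p` and `i` are annihilated by `jb = dh + hd`.
  have hpj : ∀ y, p (j y) = 0 := fun y => by
    rw [← hbj y, hjb, map_add, R.p_d, R.p_h, add_zero]
  have hbi : ∀ y, b (i y) = 0 := fun y => by
    rw [← hbj (b (i y)), hjb, R.h_i, R.d_i, map_zero, map_zero, add_zero, map_zero]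
  have hbdeg : LinDegree (b ∘ₗ d ∘ₗ j) 1 := hb.comp (hddeg.comp hj rfl) rfl
  have hbdd : ∀ x, (b ∘ₗ d ∘ₗ j) ((b ∘ₗ d ∘ₗ j) x) = 0 := fun x => by
    simp [hjb, hdd]
  -- the projections and inclusions of the direct sum
  let π₁ := DirectSum.lmap (fun d => LinearMap.fst k (A d) (B d))
  let π₂ := DirectSum.lmap (fun d => LinearMap.snd k (A d) (B d))
  let ι₁ := DirectSum.lmap (fun d => LinearMap.inl k (A d) (B d))
  let ι₂ := DirectSum.lmap (fun d => LinearMap.inr k (A d) (B d))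
  have h11 : ∀ x, π₁ (ι₁ x) = x := fun x => DFinsupp.ext fun e => rfl
  have h12 : ∀ x, π₁ (ι₂ x) = 0 := fun x => DFinsupp.ext fun e => rfl
  have h21 : ∀ x, π₂ (ι₁ x) = 0 := fun x => DFinsupp.ext fun e => rfl
  have h22 : ∀ x, π₂ (ι₂ x) = x := fun x => DFinsupp.ext fun e => rfl
  have hsum : ∀ x, ι₁ (π₁ x) + ι₂ (π₂ x) = x := fun x => DFinsupp.ext fun e => by
    simp [ι₁, π₁, ι₂, π₂]
  have hπ₁ : LinDegree π₁ 0 := linDegree_lmap _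
  have hπ₂ : LinDegree π₂ 0 := linDegree_lmap _
  have hι₁ : LinDegree ι₁ 0 := linDegree_lmap _
  have hι₂ : LinDegree ι₂ 0 := linDegree_lmap _
  -- the corestriction of the isomorphism
  let f : TensorCoalg k H →ₗ[k] ⨁ d, A d × B d :=
    ι₁ ∘ₗ ιInv ∘ₗ q.toLinearMap +
      ι₂ ∘ₗ b ∘ₗ (d ∘ₗ h ∘ₗ ιInv + h ∘ₗ ιInv ∘ₗ X.codiff)
  have hf : ∀ x, f x = ι₁ (ιInv (q.toLinearMap x)) +
    ι₂ (b (d (h (ιInv x)) + h (ιInv (X.codiff x)))) := fun x => rfl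
  have hq1 : ιInv (q.toLinearMap 1) = 0 := by
    have := congrArg (fun g => g (fun _ => 0)) q.component_zero
    simpa [component_apply] using this
  have hf1 : f 1 = 0 := by simp [hf, hq1, X.codiff_one]
  have hfdeg : ∀ e, ∀ x ∈ tensorDegree k H e, f x ∈ piece k (fun d => A d × B d) e := by
    intro e x hx
    have h1 := hι₁ e _ (ιInv_mem_piece (q.degree_zero e x hx))
    have h2 := hι₂.comp (hb.comp (hddeg.comp hh rfl) rfl) rfl e _ (ιInv_mem_piece hx)
    have h3 := hι₂.comp (hb.comp hh rfl) rfl _ _ (ιInv_mem_piece (X.degree_one e x hx))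
    rw [hf, map_add, map_add]
    refine add_mem (by simpa using h1) (add_mem (by simpa using h2) (by simpa using h3))
  have hfι : ∀ a, f (ι k a) = ι₁ (p a) + ι₂ (b a) := by
    intro a
    rw [hf, hqι, ιInv_ι, ιInv_ι, hd_def, ← hjb, hbj]
  -- The inverse of the linear part `(p, b)` of the corestriction.
  let g := i ∘ₗ π₁ + j ∘ₗ π₂
  have hgf : ∀ a, g (f (ι k a)) = a := by
    intro a
    have := R.homotopy a
    simp [hfι, g, h11, h12, h21, h22, hjb, this]
  have hfg : ∀ y, f (ι k (g y)) = y := by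
    intro y
    rw [hfι]
    simp [g, R.p_i, hpj, hbi, hbj, hsum]
  have hgdeg : LinDegree g 0 := (hi.comp hπ₁ rfl).add (hj.comp hπ₂ rfl)
  have hgF : (tmap g).comp (tmap (f ∘ₗ ι k)) = AlgHom.id k _ := by
    rw [← tmap_comp, show g ∘ₗ f ∘ₗ ι k = LinearMap.id from LinearMap.ext hgf, tmap_id]
  have hFg : (tmap (f ∘ₗ ι k)).comp (tmap g) = AlgHom.id k _ := by
    rw [← tmap_comp, show (f ∘ₗ ι k) ∘ₗ g = LinearMap.id from LinearMap.ext hfg, tmap_id]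
  have hgFx : ∀ x, tmap g (tmap (f ∘ₗ ι k) x) = x := fun x => congrArg (fun φ => φ x) hgF
  have hFgx : ∀ x, tmap (f ∘ₗ ι k) (tmap g x) = x := fun x => congrArg (fun φ => φ x) hFg
  -- Undoing the linear part turns `cofree f` into `1 + N` with `N` shortening words, which makes it
  -- bijective.
  let N := (tmap g).toLinearMap ∘ₗ (cofree f - (tmap (f ∘ₗ ι k)).toLinearMap)
  have hN : ∀ n, ∀ x ∈ filt k (⨁ d, H d) (n + 1), N x ∈ filt k (⨁ d, H d) n :=
    fun n x hx => tmap_mem_filt _ (cofree_sub_tmap_mem_filt f hx)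
  have hgN : ∀ x, x + N x = tmap g (cofree f x) := by
    intro x
    simp [N, hgFx]
  have hFdeg : HasDegree (cofree f) 0 := hasDegree_cofree hfdeg
  have hNdeg : HasDegree N 0 := by
    have : LinDegree (f ∘ₗ ι k) 0 := fun e x hx => by
      simpa using hfdeg e _ (ι_mem_tensorDegree hx)
    exact (hasDegree_tmap hgdeg).comp (hFdeg.sub (hasDegree_tmap this)) rfl
  have hinj : Function.Injective (cofree f) := by
    intro x y hxy
    refine injective_add_of_lowers hN ?_
    simp only [LinearMap.add_apply, LinearMap.id_apply, hgN, hxy]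
  have hsurj : Function.Surjective (cofree f) := by
    intro y
    obtain ⟨x, hx⟩ := surjective_add_of_lowers hN (tmap g y)
    simp only [LinearMap.add_apply, LinearMap.id_apply, hgN] at hx
    refine ⟨x, ?_⟩
    rw [← hFgx (cofree f x), hx, hFgx]
  let e := LinearEquiv.ofBijective _ ⟨hinj, hsurj⟩
  have he : ∀ x, e.symm (cofree f x) = x := e.symm_apply_apply
  have hedeg : HasDegree e.symm.toLinearMap 0 := by
    intro c x hx
    obtain ⟨y, rfl⟩ := hsurj x
    rw [LinearEquiv.coe_coe, he, add_zero]
    refine mem_of_add_mem_of_lowers hN (tensorDegree k H c)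
      (fun x hx => by simpa using hNdeg c x hx) y ?_
    rw [hgN]
    simpa using hasDegree_tmap hgdeg c _ hx
  let S := X.push (cofree f) (cofree f ∘ₗ X.codiff ∘ₗ e.symm.toLinearMap) hFdeg
    (hFdeg.comp (HasDegree.comp X.degree_one hedeg rfl) rfl) (deconcat_cofree f) (cofree_one f)
    hsurj (fun x => by simp [he])
  have hS : ∀ x, S.codiff (cofree f x) = cofree f (X.codiff x) := fun x =>
    congrArg (fun y => cofree f (X.codiff y)) (he x)
  -- Both are counital coalgebra homomorphisms with the same corestriction, so the `A` part of the
  -- isomorphism is the morphism `q` itself.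
  have hqF : (tmap π₁).toLinearMap ∘ₗ cofree f = q.toLinearMap := by
    refine coalgebraHom_ext ?_ q.deconcat_comp (fun x => ?_) q.counit_comp (fun x => ?_) ?_
    · rw [← LinearMap.comp_assoc, deconcat_tmap, LinearMap.comp_assoc, deconcat_cofree,
        ← LinearMap.comp_assoc, ← TensorProduct.map_comp]
    · rw [LinearMap.comp_apply, AlgHom.toLinearMap_apply, algebraMapInv_tmap,
        algebraMapInv_cofree]
    · rw [LinearMap.comp_apply, AlgHom.toLinearMap_apply, ιInv_tmap, ιInv_cofree hf1, hf,
        map_add, h11, h12, add_zero]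
    · simp
  refine ⟨M, AInfinityAlgebra.ofDifferential (b ∘ₗ d ∘ₗ j) hbdeg hbdd, S, hM, ⟨?_, ?_⟩, ?_,
    ⟨cofree f, fun c x hx => by simpa using hFdeg c x hx, algebraMapInv_cofree f,
      deconcat_cofree f, LinearMap.ext fun x => (hS x).symm,
      component_zero_eq_zero (by simp)⟩, ?_⟩
  · intro n hn
    obtain ⟨n, rfl⟩ : ∃ l, n = l + 2 := ⟨n - 2, by omega⟩
    refine MultilinearMap.ext fun o => ?_
    rw [AInfinityAlgebra.ofDifferential_m]
    simp [List.ofFn_succ]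
  · intro x hx
    -- If `x` is closed in `B`, then `j x` is closed in `H`, so `j x = j (b (j x)) = d (h (j x))`,
    -- and the primitive `h (j x)` is projected back to `B`.
    refine ⟨b (h (j x)), ?_⟩
    rw [AInfinityAlgebra.ofDifferential_m] at hx ⊢
    have hx' : j (b (d (j x))) = 0 := by simpa using congrArg j hx
    rw [hjb, hdd, map_zero, add_zero, hdhd] at hx'
    have hbx : b (d (h (j x))) = x := by
      have := congrArg b (hjb (j x))
      rwa [hx', map_zero, add_zero, hbj, hbj, eq_comm] at this
    simp [hjb, hdd, hdhd, hbx]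
  · intro n o
    -- Pulling the word back along `F` replaces the operation on `S` by `f (𝔪 x)`; the two
    -- projections then reduce to `q` and the `B` part of `f` being chain maps.
    obtain ⟨x, hx⟩ := hsurj (word k (List.ofFn o))
    have hm : S.m n o = f (X.codiff x) := by
      rw [AInfinityAlgebra.m, component_apply, ← hx, hS, ιInv_cofree hf1]
    constructor
    · have h1 : word k (List.ofFn fun l => π₁ (o l)) = q.toLinearMap x := by
        rw [← hqF, LinearMap.comp_apply, hx, AlgHom.toLinearMap_apply, tmap_word, List.map_ofFn]
        rfl
      have h2 := LinearMap.congr_fun q.comm x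
      rw [LinearMap.comp_apply, LinearMap.comp_apply] at h2
      change π₁ (S.m n o) = M.m n fun l => π₁ (o l)
      rw [hm, AInfinityAlgebra.m, component_apply, h1, ← h2, hf, map_add, h11, h12, add_zero]
    · have h1 : word k (List.ofFn fun l => π₂ (o l)) = tmap π₂ (cofree f x) := by
        rw [hx, tmap_word, List.map_ofFn]
        rfl
      change π₂ (S.m n o) = AInfinityAlgebra.m _ n fun l => π₂ (o l)
      -- With `φ = h ∘ ιInv`, both `d(dφ + φ𝔪)` and `(dφ + φ𝔪)𝔪` equal `dφ𝔪`; and `b` intertwines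
      -- `d` with `bdj` because `jb = dh + hd` commutes with `d`.
      have hπf : ∀ x, π₂ (f x) = b (d (h (ιInv x)) + h (ιInv (X.codiff x))) := fun x => by
        rw [hf, map_add, h21, h22, zero_add]
      rw [hm, AInfinityAlgebra.ofDifferential_m, h1, ιInv_tmap, ιInv_cofree hf1, hπf, hπf,
        X.codiff_codiff]
      simp [hjb, hdd, hdhd]
  · have : ∀ x, component (cofree f) 1 (fun _ => x) = f (ι k x) := fun x => by
      rw [component_one_apply, ιInv_cofree hf1]
    refine ⟨fun x y hxy => ?_, fun y => ⟨g y, (this _).trans (hfg y)⟩⟩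
    have hxy' : f (ι k x) = f (ι k y) := (this x).symm.trans (Eq.trans hxy (this y))
    rw [← hgf x, hxy', hgf]

end Decomposition

end AInfinity

end

/-! ### The decomposition theorem. -/

theorem theorem4p2 {k : Type v} [Field k] [CharZero k]
    {H : ℤ → Type u} [∀ d, AddCommGroup (H d)] [∀ d, Module k (H d)]
    (X : AInfinity.AInfinityAlgebra k H) :
    ∃ (A B : ℤ → Type u)
      (_ : ∀ d, AddCommGroup (A d)) (_ : ∀ d, Module k (A d))
      (_ : ∀ d, AddCommGroup (B d)) (_ : ∀ d, Module k (B d))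
      (M : AInfinity.AInfinityAlgebra k A) (L : AInfinity.AInfinityAlgebra k B)
      (S : AInfinity.AInfinityAlgebra k (fun d => A d × B d)),
      M.IsMinimal ∧ L.IsLinearContractible ∧ S.IsDirectSum M L ∧
        ∃ F : AInfinity.AInfinityMorphism X S, F.IsIso := by
  obtain ⟨h, hh, hdhd, hhdh, hhh⟩ := AInfinity.exists_homotopy X.linDegree_differential
    (LinearMap.ext X.differential_differential)
  replace hdhd := LinearMap.congr_fun hdhd
  replace hhdh := LinearMap.congr_fun hhdh
  replace hhh := LinearMap.congr_fun hhh
  have hdd := X.differential_differential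
  have hd := X.linDegree_differential
  simp only [LinearMap.comp_apply, LinearMap.zero_apply] at hdhd hhdh hhh
  -- `dh + hd` is idempotent of degree zero: its image is `B`, and `A` is the image of the
  -- complementary idempotent. The side conditions of the retract then follow from `hdh = h`, `h² =
  -- 0` and `dhd = d`.
  have hQ : AInfinity.LinDegree (X.differential ∘ₗ h + h ∘ₗ X.differential) 0 :=
    (hd.comp hh rfl).add (hh.comp hd rfl)
  obtain ⟨A, _, _, p, i, hp, hi, hpi, hip⟩ := AInfinity.exists_split_idempotent
    (AInfinity.LinDegree.id.sub hQ) (fun x => by simp [hdd, hhh, hdhd, hhdh])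
  obtain ⟨B, _, _, b, j, hb, hj, hbj, hjb⟩ := AInfinity.exists_split_idempotent
    hQ (fun x => by simp [hdd, hhh, hdhd, hhdh])
  simp only [LinearMap.sub_apply, LinearMap.add_apply, LinearMap.comp_apply,
    LinearMap.id_apply] at hip hjb
  have R : AInfinity.IsRetract (AInfinity.signMap k H) X.differential h p i :=
    { σ_σ := AInfinity.signMap_signMap
      σ_d := hd.signMap
      d_d := hdd
      homotopy := fun x => by rw [hip]; abel
      h_h := hhh
      h_i := fun x => by rw [← hpi x, hip]; simp [hhh, hhdh]
      p_h := fun x => by rw [← hpi (p (h x)), hip]; simp [hhh, hhdh]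
      p_d := fun x => by rw [← hpi (p (X.differential x)), hip]; simp [hdd, hdhd]
      d_i := fun x => by rw [← hpi x, hip]; simp [hdd, hdhd]
      p_i := hpi }
  exact ⟨A, B, _, _, _, _, AInfinity.exists_decomposition_of_splitting X R hh hp hi hb hj hdhd
    hbj hjb⟩
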